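/- Let $\eta_+\approx 2.46$ be the unique positive root of the polynomial $T^3-T^2-2T-4$. For a group $W$ with a finite generating set $S$ and a real number $r\ge 0$, let $v_{W,S}(r)$ be the number of elements of $W$ that are products of at most $r$ elements of $S\cup S^{-1}$, and let $\lambda_{W,S}=\lim_{R\to\infty}\frac{\log v_{W,S}(R)}{R}$ (this limit always exists). A finitely generated group $W$ has non-uniform exponential growth if $\lambda_{W,S}>0$ for every finite generating set $S$ of $W$, but $\inf_S\lambda_{W,S}=0$, the infimum being over all finite generating sets $S$ of $W$. Theorem. Every countable group $B$ embeds in a group $W$ of non-uniform exponential growth. Moreover, $W$ can be chosen such that the following holds as well: there is a constant $K$ such that, for every real $R>0$, there is a finite generating set $S$ of $W$ with $$v_{W,S}(r)\le\exp\left(K\,r^{\log 2/\log\eta_+}\right)\quad\text{for all real } r\in[0,R].$$ -/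

import Mathlib

open Filter Topology

universe u

/-- The ball of radius `r` around `1` in the Cayley graph of `G` with respect to `S`: the elements
of `G` that are products of at most `r` letters, each of which is in `S` or inverse to one in `S`. -/
def wordBall {G : Type u} [Group G] (S : Finset G) (r : ℝ) : Set G :=
  {g | ∃ l : List G, (∀ x ∈ l, x ∈ S ∨ x⁻¹ ∈ S) ∧ (l.length : ℝ) ≤ r ∧ l.prod = g}

/-- The growth function `v_{G,S}(r)`, the number of elements of the ball of radius `r`. -/
noncomputable def growth {G : Type u} [Group G] (S : Finset G) (r : ℝ) : ℕ :=
  (wordBall S r).ncard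

theorem wordBall_floor {G : Type u} [Group G] (S : Finset G) {r : ℝ} (hr : 0 ≤ r) :
    wordBall S (⌊r⌋₊ : ℝ) = wordBall S r := by
  ext g
  simp only [wordBall, Set.mem_ofPred_eq, Nat.cast_le, Nat.le_floor_iff hr]

theorem one_mem_wordBall {G : Type u} [Group G] (S : Finset G) {r : ℝ} (hr : 0 ≤ r) :
    (1 : G) ∈ wordBall S r :=
  ⟨[], by simp, by simpa using hr, rfl⟩

theorem wordBall_add_subset {G : Type u} [Group G] (S : Finset G) (m n : ℕ) :
    wordBall S ((m + n : ℕ) : ℝ) ⊆ Set.image2 (· * ·) (wordBall S (m : ℝ)) (wordBall S (n : ℝ)) := by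
  rintro g ⟨l, hl, hlen, rfl⟩
  have hlen' : l.length ≤ m + n := by exact_mod_cast hlen
  refine ⟨(l.take m).prod, ⟨l.take m, fun x hx => hl x (List.mem_of_mem_take hx), ?_, rfl⟩,
    (l.drop m).prod, ⟨l.drop m, fun x hx => hl x (List.mem_of_mem_drop hx), ?_, rfl⟩, ?_⟩
  · exact_mod_cast (List.length_take_le m l)
  · have : (l.drop m).length ≤ n := by rw [List.length_drop]; omega
    exact_mod_cast this
  · exact List.prod_take_mul_prod_drop l m

theorem wordBall_finite {G : Type u} [Group G] (S : Finset G) (r : ℝ) :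
    (wordBall S r).Finite := by
  have key : ∀ n : ℕ, (wordBall S (n : ℝ)).Finite := by
    intro n
    induction n with
    | zero =>
      refine (Set.finite_singleton (1 : G)).subset ?_
      rintro g ⟨l, -, hlen, rfl⟩
      have : l.length = 0 := by
        have h : l.length ≤ 0 := by exact_mod_cast hlen
        omega
      simp [List.length_eq_zero_iff.mp this]
    | succ k ih =>
      have h1 : (wordBall S ((1 : ℕ) : ℝ)).Finite := by
        refine (((S.finite_toSet).union (S.finite_toSet.image (·⁻¹))).insert (1 : G)).subset ?_
        rintro g ⟨l, hl, hlen, rfl⟩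
        have h : l.length ≤ 1 := by exact_mod_cast hlen
        rcases l with _ | ⟨x, _ | ⟨y, l⟩⟩
        · simp
        · rcases hl x (by simp) with hx | hx
          · simp [hx]
          · simp [hx]
        · simp at h
      exact (Set.Finite.image2 _ ih h1).subset (wordBall_add_subset S k 1)
  rcases le_or_gt 0 r with hr | hr
  · rw [← wordBall_floor S hr]; exact key _
  · refine Set.finite_empty.subset ?_
    rintro g ⟨l, -, hlen, -⟩
    exact absurd (hlen.trans_lt hr) (not_lt.mpr (Nat.cast_nonneg _))

theorem growth_pos {G : Type u} [Group G] (S : Finset G) {r : ℝ} (hr : 0 ≤ r) :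
    0 < growth S r :=
  (Set.ncard_pos (wordBall_finite S r)).mpr ⟨1, one_mem_wordBall S hr⟩

theorem growth_add_le {G : Type u} [Group G] (S : Finset G) (m n : ℕ) :
    growth S ((m + n : ℕ) : ℝ) ≤ growth S (m : ℝ) * growth S (n : ℝ) := by
  have hm := wordBall_finite S (m : ℝ)
  have hn := wordBall_finite S (n : ℝ)
  refine (Set.ncard_le_ncard (wordBall_add_subset S m n) (Set.Finite.image2 _ hm hn)).trans ?_
  unfold growth
  rw [← Set.image_prod, ← Set.ncard_prod]
  exact Set.ncard_image_le (hm.prod hn)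

/-- The volume entropy `λ_{G,S}`, the limit of `log v_{G,S}(R) / R` as `R → ∞`
(it exists by `tendsto_volumeEntropy`). -/
noncomputable def volumeEntropy {G : Type u} [Group G] (S : Finset G) : ℝ :=
  limUnder atTop (fun R : ℝ => Real.log (growth S R) / R)

theorem tendsto_volumeEntropy {G : Type u} [Group G] (S : Finset G) :
    Tendsto (fun R : ℝ => Real.log (growth S R) / R) atTop (𝓝 (volumeEntropy S)) := by
  have hsub : Subadditive (fun n : ℕ => Real.log (growth S (n : ℝ))) := by
    intro m n
    have hm : (growth S (m : ℝ) : ℝ) ≠ 0 := by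
      exact_mod_cast (growth_pos S (Nat.cast_nonneg m)).ne'
    have hn : (growth S (n : ℝ) : ℝ) ≠ 0 := by
      exact_mod_cast (growth_pos S (Nat.cast_nonneg n)).ne'
    rw [← Real.log_mul hm hn]
    refine Real.log_le_log ?_ ?_
    · exact_mod_cast growth_pos S (Nat.cast_nonneg (m + n))
    · exact_mod_cast growth_add_le S m n
  have hlim := hsub.tendsto_lim ⟨0, by
    rintro _ ⟨n, rfl⟩
    exact div_nonneg (Real.log_natCast_nonneg _) (Nat.cast_nonneg n)⟩
  refine tendsto_nhds_limUnder ⟨hsub.lim, ?_⟩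
  have h2 := (hlim.comp (tendsto_nat_floor_atTop (α := ℝ))).mul
    (tendsto_nat_floor_div_atTop (R := ℝ))
  rw [mul_one] at h2
  refine h2.congr' ?_
  filter_upwards [eventually_ge_atTop (1 : ℝ)] with R hR
  have h0 : (⌊R⌋₊ : ℝ) ≠ 0 := by
    exact_mod_cast (Nat.floor_pos.mpr hR).ne'
  have hg : growth S (⌊R⌋₊ : ℝ) = growth S R := by
    unfold growth; rw [wordBall_floor S (by linarith)]
  simp only [Function.comp_apply, hg]
  field_simp

/-- `G` has non-uniform exponential growth: `G` is finitely generated, `λ_{G,S} > 0` for every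
finite generating set `S`, and the infimum of `λ_{G,S}` over all finite generating sets is `0`. -/
def HasNonuniformExponentialGrowth (G : Type u) [Group G] : Prop :=
  Group.FG G ∧
  (∀ S : Finset G, Subgroup.closure (S : Set G) = ⊤ → 0 < volumeEntropy S) ∧
  IsGLB {c : ℝ | ∃ S : Finset G, Subgroup.closure (S : Set G) = ⊤ ∧ volumeEntropy S = c} 0

theorem existsUnique_pos_root :
    ∃! x : ℝ, 0 < x ∧ x ^ 3 - x ^ 2 - 2 * x - 4 = 0 := by
  have hc : ContinuousOn (fun x : ℝ => x ^ 3 - x ^ 2 - 2 * x - 4) (Set.Icc 2 3) := by fun_prop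
  obtain ⟨x, hx, hx0⟩ := intermediate_value_Icc (by norm_num : (2 : ℝ) ≤ 3) hc
    (show (0 : ℝ) ∈ _ by constructor <;> norm_num)
  refine ⟨x, ⟨by linarith [hx.1], hx0⟩, ?_⟩
  rintro y ⟨hy, hy0⟩
  have hx0' : x ^ 3 - x ^ 2 - 2 * x - 4 = 0 := hx0
  have hx2 : 2 ≤ x := hx.1
  have hfac : (y - x) * (y ^ 2 + y * (x - 1) + (x ^ 2 - x - 2)) = 0 := by
    linear_combination hy0 - hx0'
  have hpos : 0 < y ^ 2 + y * (x - 1) + (x ^ 2 - x - 2) := by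
    nlinarith [mul_pos hy (by linarith : (0 : ℝ) < x - 1), sq_nonneg (x - 2), pow_pos hy 2]
  rcases mul_eq_zero.mp hfac with h | h
  · linarith
  · exact absurd h hpos.ne'

/-- The positive root `η₊ ≈ 2.46` of the polynomial `T³ - T² - 2T - 4`. -/
noncomputable def etaPlus : ℝ := Classical.choose existsUnique_pos_root.exists

theorem etaPlus_spec : 0 < etaPlus ∧ etaPlus ^ 3 - etaPlus ^ 2 - 2 * etaPlus - 4 = 0 :=
  Classical.choose_spec existsUnique_pos_root.exists

/-! The group `W` acts on `Ray × Z`. It is generated by the Grigorchuk group, acting on rays, and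
one fibrewise permutation (the decoration) equal to `b n` over the two rays `1^n 0 * 1^∞` and
trivial elsewhere. These spots drift ever further apart in the orbit of `1^∞`.

The sequence `b` is recurrent: each term is a product of commutators of arbitrarily late terms.
Commutators of translated decorations have finite support, and since the Grigorchuk group is weakly
branch they can be cut down to one ray. So `W` contains every `b n` placed over a single ray, and
erasing the first `N` values of the decoration leaves `W` unchanged (`Recurrent.decorated_eq`).

With respect to the truncated generators a word of length at most `N / 2` sees at most one spot from
any starting ray. As all `b n` satisfy `b n ^ 60 = 1`, its value is determined by its value in one
local model, where the decoration is a generator of `ZMod 60` over `1^∞` (`wordValue_eq_of_model`).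
The model does not depend on `N`. Weights on letters that contract under passage to sections bound
its growth by `exp (K r ^ θ)` with `θ < 1` (`exists_model_growth`). Hence large balls are small, and
the infimum of the entropies is `0`.

A suitable `b` comes from the perfect group `A_5` and makes its late commutators contain any given
countable group (`exists_recurrent`). Applied to `B × F_2`, this embeds `B`, and the free factor
forces positive entropy for every generating set (`volumeEntropy_pos_of_freeGroup`). -/

namespace Monomial

/-! ### Permutations of a product: fibrewise ones and those of the first coordinate. -/

open Equiv

/-- The fibrewise permutation of `X × Z` given by a family of permutations of `Z`. -/
def base {X Z : Type*} : (X → Perm Z) →* Perm (X × Z) where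
  toFun φ := Equiv.prodCongrRight φ
  map_one' := by ext ⟨x, z⟩ <;> rfl
  map_mul' φ χ := by ext ⟨x, z⟩ <;> rfl

/-- The permutation of `X × Z` acting on the first coordinate. -/
def top {X Z : Type*} : Perm X →* Perm (X × Z) where
  toFun g := Equiv.prodCongrLeft fun _ => g
  map_one' := by ext ⟨x, z⟩ <;> rfl
  map_mul' φ χ := by ext ⟨x, z⟩ <;> rfl

variable {X Z : Type*}

@[simp] theorem base_apply (φ : X → Perm Z) (p : X × Z) : base φ p = (p.1, φ p.1 p.2) := rfl

@[simp] theorem top_apply (g : Perm X) (p : X × Z) :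
    (top g : Perm (X × Z)) p = (g p.1, p.2) := rfl

theorem top_mul_base_mul_inv (g : Perm X) (φ : X → Perm Z) :
    top g * base φ * (top g)⁻¹ = base (fun x => φ (g⁻¹ x)) := by
  rw [mul_inv_eq_iff_eq_mul]
  ext ⟨x, z⟩ <;> simp [Perm.mul_apply]

theorem base_injective : Function.Injective (base : (X → Perm Z) →* Perm (X × Z)) := by
  intro φ χ h
  ext x z
  have := congrArg (fun p : Perm (X × Z) => (p (x, z)).2) h
  simpa using this

end Monomial

/-! ### The generators of the Grigorchuk group as permutations of rays. -/

namespace Grig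

open Equiv Function

/-- The boundary of the binary tree; `true` and `false` are the letters `1` and `0`. -/
abbrev Ray := ℕ → Bool

noncomputable instance : DecidableEq Ray := Classical.decEq _

/-- The ray starting with `i` and continuing with `x`. -/
def cons (i : Bool) (x : Ray) : Ray := fun n => Nat.casesOn n i x

@[simp] theorem cons_zero (i : Bool) (x : Ray) : cons i x 0 = i := rfl
@[simp] theorem cons_succ (i : Bool) (x : Ray) (n : ℕ) : cons i x (n + 1) = x n := rfl

theorem cons_head_tail (x : Ray) : cons (x 0) (fun n => x (n + 1)) = x := by
  ext n; cases n <;> rfl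

theorem exists_cons (x : Ray) : ∃ i y, x = cons i y := ⟨_, _, (cons_head_tail x).symm⟩

theorem cons_inj {i j : Bool} {x y : Ray} : cons i x = cons j y ↔ i = j ∧ x = y := by
  refine ⟨fun h => ⟨congrFun h 0, funext fun n => congrFun h (n + 1)⟩, ?_⟩
  rintro ⟨rfl, rfl⟩; rfl

/-- The first zero of `x` is at position `n`. -/
def FirstZero (x : Ray) (n : ℕ) : Prop := (∀ i < n, x i = true) ∧ x n = false

theorem FirstZero.unique {x : Ray} {m n : ℕ} (hm : FirstZero x m) (hn : FirstZero x n) :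
    m = n := by
  rcases lt_trichotomy m n with h | h | h
  · have := hn.1 m h; rw [hm.2] at this; cases this
  · exact h
  · have := hm.1 n h; rw [hn.2] at this; cases this

/-- The map changing the first letter. -/
def flipFun (x : Ray) : Ray := cons (!x 0) fun n => x (n + 1)

theorem flipFun_involutive : Involutive flipFun := by
  intro x; ext n; cases n <;> simp [flipFun]

/-- The rooted generator of the Grigorchuk group. -/
def rot : Perm Ray := flipFun_involutive.toPerm

@[simp] theorem rot_cons (i : Bool) (x : Ray) : rot (cons i x) = cons (!i) x := rfl
@[simp] theorem rot_zero (x : Ray) : rot x 0 = !x 0 := rfl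
@[simp] theorem rot_succ (x : Ray) (n : ℕ) : rot x (n + 1) = x (n + 1) := rfl
@[simp] theorem rot_mul_rot : rot * rot = 1 := by
  ext1 x; exact flipFun_involutive x
@[simp] theorem rot_inv : rot⁻¹ = rot := inv_eq_of_mul_eq_one_left rot_mul_rot

open Classical in
/-- The map changing the letter after the first zero, if that zero is at a position in `e`. -/
noncomputable def dirFun (e : ℕ → Bool) (x : Ray) : Ray :=
  cons (x 0) fun n => if FirstZero x n ∧ e n then !x (n + 1) else x (n + 1)

theorem dirFun_of_le {e : ℕ → Bool} {x : Ray} {n i : ℕ} (h : FirstZero x n) (hi : i ≤ n) :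
    dirFun e x i = x i := by
  cases i with
  | zero => rfl
  | succ i =>
    refine if_neg fun hc => ?_
    have := hc.1.unique h
    omega

theorem FirstZero.dirFun {e : ℕ → Bool} {x : Ray} {n : ℕ} (h : FirstZero x n) :
    FirstZero (dirFun e x) n :=
  ⟨fun i hi => by rw [dirFun_of_le h hi.le]; exact h.1 i hi,
    by rw [dirFun_of_le h le_rfl]; exact h.2⟩

/-- Only the letter after the first zero can change, so the first zero stays put. This is what makes
directed maps compose by adding their activities. -/
theorem firstZero_dirFun_iff {e : ℕ → Bool} {x : Ray} {n : ℕ} :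
    FirstZero (dirFun e x) n ↔ FirstZero x n := by
  refine ⟨fun h => ?_, FirstZero.dirFun⟩
  by_cases hx : ∃ m, FirstZero x m
  · obtain ⟨m, hm⟩ := hx
    have := hm.dirFun (e := e)
    rwa [h.unique this]
  · have : Grig.dirFun e x = x := by
      ext i
      cases i with
      | zero => rfl
      | succ i => exact if_neg fun hc => hx ⟨i, hc.1⟩
    rwa [this] at h

open Classical in
theorem dirFun_dirFun (e e' : ℕ → Bool) (x : Ray) :
    dirFun e (dirFun e' x) = dirFun (fun n => xor (e n) (e' n)) x := by
  ext i
  cases i with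
  | zero => rfl
  | succ i =>
    change (if FirstZero (dirFun e' x) i ∧ e i then !(dirFun e' x (i + 1))
      else dirFun e' x (i + 1)) = if FirstZero x i ∧ _ then _ else _
    rw [firstZero_dirFun_iff]
    change (if _ then !(if FirstZero x i ∧ e' i then !x (i + 1) else x (i + 1))
      else if FirstZero x i ∧ e' i then !x (i + 1) else x (i + 1)) = _
    by_cases h : FirstZero x i <;> cases he : e i <;> cases he' : e' i <;> simp [h, he, he']

theorem dirFun_false (x : Ray) : dirFun (fun _ => false) x = x := by
  ext i; cases i <;> simp [dirFun]

theorem dirFun_involutive (e : ℕ → Bool) : Involutive (dirFun e) := by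
  intro x; rw [dirFun_dirFun]; simp [dirFun_false]

/-- The directed automorphism with activity `e`. -/
noncomputable def dir (e : ℕ → Bool) : Perm Ray := (dirFun_involutive e).toPerm

@[simp] theorem dir_zero (e : ℕ → Bool) (x : Ray) : dir e x 0 = x 0 := rfl

open Classical in
theorem dir_succ (e : ℕ → Bool) (x : Ray) (n : ℕ) :
    dir e x (n + 1) = if FirstZero x n ∧ e n then !x (n + 1) else x (n + 1) := rfl

theorem dir_mul (e e' : ℕ → Bool) : dir e * dir e' = dir fun n => xor (e n) (e' n) := by
  ext1 x; exact dirFun_dirFun e e' x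

theorem dir_false : dir (fun _ => false) = 1 := by
  ext1 x; exact dirFun_false x

theorem dir_inv (e : ℕ → Bool) : (dir e)⁻¹ = dir e := by
  refine inv_eq_of_mul_eq_one_left ?_
  rw [dir_mul]; simp [dir_false]

theorem firstZero_cons_true {x : Ray} {n : ℕ} :
    FirstZero (cons true x) (n + 1) ↔ FirstZero x n := by
  constructor
  · intro h
    exact ⟨fun i hi => h.1 (i + 1) (by omega), h.2⟩
  · intro h
    refine ⟨fun i hi => ?_, h.2⟩
    cases i with
    | zero => rfl
    | succ i => exact h.1 i (by omega)

theorem dir_cons_true (e : ℕ → Bool) (x : Ray) :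
    dir e (cons true x) = cons true (dir (fun n => e (n + 1)) x) := by
  ext i
  rcases i with _ | _ | i
  · rfl
  · rw [dir_succ, if_neg (by simp [FirstZero])]; rfl
  · rw [dir_succ, firstZero_cons_true]; rfl

theorem dir_cons_false (e : ℕ → Bool) (x : Ray) :
    dir e (cons false x) = cons false (if e 0 then rot x else x) := by
  have h : FirstZero (cons false x) 0 := ⟨by simp, rfl⟩
  ext i
  rcases i with _ | _ | i
  · rfl
  · rw [dir_succ]
    cases e 0 <;> simp [h]
  · rw [dir_succ, if_neg (fun hc => by have := hc.1.unique h; omega)]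
    cases e 0 <;> simp

/-- The Klein four-group of directed generators, with the shift of their activities. -/
abbrev Klein := Bool × Bool

/-- The section of a directed generator along the infinite ray. -/
def Klein.shift (v : Klein) : Klein := (v.2, xor v.1 v.2)

/-- The activity of a directed generator. -/
def activity (v : Klein) (n : ℕ) : Bool := (Klein.shift^[n] v).1

theorem activity_succ (v : Klein) (n : ℕ) : activity v (n + 1) = activity v.shift n := rfl

/-- The product in the Klein four-group. -/
def Klein.add (v w : Klein) : Klein := (xor v.1 w.1, xor v.2 w.2)

theorem activity_add (v w : Klein) (n : ℕ) :
    activity (v.add w) n = xor (activity v n) (activity w n) := by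
  induction n generalizing v w with
  | zero => rfl
  | succ n ih =>
    rw [activity_succ, activity_succ, activity_succ, ← ih]
    congr 1
    revert v w; unfold Klein.add Klein.shift; decide

/-- The directed generators of the Grigorchuk group: `b = (1, 1)`, `c = (1, 0)`, `d = (0, 1)`. -/
noncomputable def kdir (v : Klein) : Perm Ray := dir (activity v)

theorem kdir_mul (v w : Klein) : kdir v * kdir w = kdir (v.add w) := by
  rw [kdir, kdir, dir_mul, kdir]
  congr 1; ext n; rw [activity_add]

@[simp] theorem kdir_inv (v : Klein) : (kdir v)⁻¹ = kdir v := dir_inv _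

theorem kdir_one : kdir (false, false) = 1 := by
  have : activity (false, false) = fun _ => false := by
    ext n
    induction n with
    | zero => rfl
    | succ n ih => exact ih
  rw [kdir, this, dir_false]

-- With `kdir_cons_false` this is the usual recursion `b = (a, c)`, `c = (a, d)`, `d = (1, b)`, the
-- section at `0` being written first.
@[simp] theorem kdir_cons_true (v : Klein) (x : Ray) :
    kdir v (cons true x) = cons true (kdir v.shift x) := dir_cons_true _ _

@[simp] theorem kdir_cons_false (v : Klein) (x : Ray) :
    kdir v (cons false x) = cons false (if v.1 then rot x else x) := dir_cons_false _ _

/-- The ray `1^∞`. -/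
def ones : Ray := fun _ => true

@[simp] theorem cons_true_ones : cons true ones = ones := by
  ext n; cases n <;> rfl

theorem kdir_ones (v : Klein) : kdir v ones = ones := by
  ext n
  cases n with
  | zero => rfl
  | succ n => rw [kdir, dir_succ, if_neg (by simp [FirstZero, ones])]

end Grig

/-! ### Geometry of the orbit of `1^∞` near the spots. -/

namespace Grig

open Equiv Function

/-- The rays `x` with `x n = 0`, continuing with `1^∞` after position `n + 1`, and with only
ones from position `s` to position `n - 1`. -/
def Near (n s : ℕ) (x : Ray) : Prop :=
  x n = false ∧ (∀ i, n + 2 ≤ i → x i = true) ∧ ∀ i, s ≤ i → i < n → x i = true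

theorem Near.mono {n s t : ℕ} {x : Ray} (h : Near n s x) (hst : s ≤ t) : Near n t x :=
  ⟨h.1, h.2.1, fun i hi => h.2.2 i (hst.trans hi)⟩

theorem Near.rot {n s : ℕ} {x : Ray} (h : Near n s x) (hs : s < n) : Near n (s + 1) (rot x) := by
  refine ⟨?_, fun i hi => ?_, fun i hi hin => ?_⟩
  · cases n with
    | zero => omega
    | succ n => exact h.1
  · cases i with
    | zero => omega
    | succ i => exact h.2.1 _ hi
  · cases i with
    | zero => omega
    | succ i => exact h.2.2 _ (by omega) hin

/-- The first zero is either before `s`, and then the altered letter has index at most `s`, or it is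
at `n`, and then the altered letter is the free one at `n + 1`. -/
theorem Near.dir {n s : ℕ} {x : Ray} (h : Near n s x) (hs : s < n) (e : ℕ → Bool) :
    Near n (s + 1) (dir e x) := by
  refine ⟨?_, fun i hi => ?_, fun i hi hin => ?_⟩
  · cases n with
    | zero => omega
    | succ n =>
      rw [dir_succ, if_neg, h.1]
      intro hc
      have := h.2.2 n (by omega) (by omega)
      rw [hc.1.2] at this; cases this
  · cases i with
    | zero => omega
    | succ i =>
      rw [dir_succ, if_neg, h.2.1 _ hi]
      intro hc
      have := hc.1.1 n (by omega)
      rw [h.1] at this; cases this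
  · cases i with
    | zero => omega
    | succ i =>
      rw [dir_succ, if_neg, h.2.2 _ (by omega) hin]
      intro hc
      have := h.2.2 i (by omega) (by omega)
      rw [hc.1.2] at this; cases this

/-- Replace all letters from position `n` on by ones. -/
def trunc (n : ℕ) (x : Ray) : Ray := fun i => if i < n then x i else true

theorem trunc_rot {n : ℕ} (hn : 0 < n) (x : Ray) : trunc n (rot x) = rot (trunc n x) := by
  ext i
  cases i with
  | zero => simp [trunc, hn]
  | succ i => rfl

/-- If the first zero is at `n`, truncation erases both that zero and the letter the generator would
change; otherwise the action takes place below position `n`. -/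
theorem Near.trunc_dir {n s : ℕ} {x : Ray} (h : Near n s x) (hs : s < n) (e : ℕ → Bool) :
    trunc n (Grig.dir e x) = Grig.dir e (trunc n x) := by
  ext i
  cases i with
  | zero => simp [trunc]
  | succ i =>
    by_cases hi : i + 1 < n
    · have : FirstZero (trunc n x) i ↔ FirstZero x i := by
        unfold FirstZero trunc
        rw [if_pos (by omega)]
        refine and_congr_left' (forall₂_congr fun j hj => ?_)
        rw [if_pos (by omega)]
      rw [dir_succ, this]
      simp only [trunc, if_pos hi]
      rw [dir_succ]
    · rw [dir_succ, if_neg]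
      · simp [trunc, hi]
      · intro hc
        have h1 := hc.1.2
        unfold trunc at h1
        split_ifs at h1 with h2
        rw [h.2.2 i (by omega) h2] at h1; cases h1

/-- The two rays `1^n 0 * 1^∞`. -/
def Spot (n : ℕ) (x : Ray) : Prop := FirstZero x n ∧ ∀ i, n + 2 ≤ i → x i = true

theorem spot_iff_near {n : ℕ} {x : Ray} : Spot n x ↔ Near n 0 x := by
  unfold Spot Near FirstZero
  constructor
  · rintro ⟨⟨h1, h2⟩, h3⟩
    exact ⟨h2, h3, fun i _ => h1 i⟩
  · rintro ⟨h2, h3, h1⟩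
    exact ⟨⟨fun i => h1 i (Nat.zero_le i), h2⟩, h3⟩

/-- A ray close to `1^n 0 * 1^∞` is in no other spot. -/
theorem Near.eq_of_spot {n m s : ℕ} {x : Ray} (h : Near n s x) (hs : s < n) (hm : Spot m x) :
    m = n := by
  have h1 : m ≤ n := by
    by_contra hc
    have := hm.1.1 n (by omega)
    rw [h.1] at this; cases this
  have h2 : n < m + 2 := by
    by_contra hc
    have := hm.2 n (by omega)
    rw [h.1] at this; cases this
  -- Only `m = n - 1` is left to exclude, and there `x` has letter `1` because `s < n`.
  by_contra h3
  have := h.2.2 m (by omega) (by omega)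
  rw [hm.1.2] at this; cases this

theorem Near.spot_iff_trunc {n s : ℕ} {x : Ray} (h : Near n s x) :
    Spot n x ↔ trunc n x = ones := by
  constructor
  · intro hx
    ext i
    unfold trunc ones
    split_ifs with hi
    · exact hx.1.1 i hi
    · rfl
  · intro hx
    refine ⟨⟨fun i hi => ?_, h.1⟩, h.2.1⟩
    have := congrFun hx i
    simpa [trunc, ones, hi] using this

/-! ### The Grigorchuk group: transitivity on cofinal rays and weak branching. -/

/-- The Grigorchuk group. -/
noncomputable def grig : Subgroup (Perm Ray) := Subgroup.closure (insert rot (Set.range kdir))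

theorem rot_mem : rot ∈ grig := Subgroup.subset_closure (Set.mem_insert _ _)

theorem kdir_mem (v : Klein) : kdir v ∈ grig :=
  Subgroup.subset_closure (Set.mem_insert_of_mem _ ⟨v, rfl⟩)

/-- Induction in the Grigorchuk group, whose generators are involutions. -/
theorem grig_induction {p : (g : Perm Ray) → g ∈ grig → Prop} (one : p 1 (one_mem _))
    (hrot : ∀ g hg, p g hg → p (rot * g) (mul_mem rot_mem hg))
    (hdir : ∀ v g hg, p g hg → p (kdir v * g) (mul_mem (kdir_mem v) hg))
    {g : Perm Ray} (hg : g ∈ grig) : p g hg := by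
  induction hg using Subgroup.closure_induction_left with
  | one => exact one
  | mul_left x hx y _ h =>
    rcases hx with rfl | ⟨v, rfl⟩
    · exact hrot _ _ h
    · exact hdir _ _ _ h
  | inv_mul_cancel x hx y _ h =>
    rcases hx with rfl | ⟨v, rfl⟩
    · simp only [rot_inv]; exact hrot _ _ h
    · simp only [kdir_inv]; exact hdir _ _ _ h

/-- An element of the Grigorchuk group moves rays by a bounded amount. -/
theorem exists_near_bound {g : Perm Ray} (hg : g ∈ grig) :
    ∃ r, ∀ n s x, s + r ≤ n → Near n s x → Near n (s + r) (g x) := by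
  induction hg using grig_induction with
  | one => exact ⟨0, fun n s x _ h => h⟩
  | hrot g _ h =>
    obtain ⟨r, hr⟩ := h
    exact ⟨r + 1, fun n s x hn h => (hr n s x (by omega) h).rot (by omega)⟩
  | hdir v g _ h =>
    obtain ⟨r, hr⟩ := h
    exact ⟨r + 1, fun n s x hn h => (hr n s x (by omega) h).dir (by omega) _⟩

/-- The stabiliser of the vertex `1` acts on its subtree as the whole group. -/
theorem exists_lift {g : Perm Ray} (hg : g ∈ grig) :
    ∃ h ∈ grig, ∃ k ∈ grig, (∀ x, h (cons true x) = cons true (g x)) ∧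
      ∀ x, h (cons false x) = cons false (k x) := by
  induction hg using grig_induction with
  | one => exact ⟨1, one_mem _, 1, one_mem _, fun _ => rfl, fun _ => rfl⟩
  | hrot g _ h =>
    obtain ⟨h, hh, k, hk, h1, h0⟩ := h
    -- The conjugate `aba = (c, a)` has section `a` at the vertex `1`.
    refine ⟨rot * kdir (true, true) * rot * h,
      mul_mem (mul_mem (mul_mem rot_mem (kdir_mem _)) rot_mem) hh,
      kdir (Klein.shift (true, true)) * k,
      mul_mem (kdir_mem _) hk, fun x => ?_, fun x => ?_⟩
    · simp [Perm.mul_apply, h1]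
    · simp [Perm.mul_apply, h0]
  | hdir v g _ h =>
    obtain ⟨h, hh, k, hk, h1, h0⟩ := h
    have hs : ∃ w : Klein, w.shift = v := by revert v; unfold Klein.shift; decide
    obtain ⟨w, hw⟩ := hs
    refine ⟨kdir w * h, mul_mem (kdir_mem _) hh, (if w.1 then rot else 1) * k,
      mul_mem ?_ hk, fun x => ?_, fun x => ?_⟩
    · split_ifs
      · exact rot_mem
      · exact one_mem _
    · simp [Perm.mul_apply, h1, hw]
    · simp only [Perm.mul_apply, h0, kdir_cons_false]
      split_ifs <;> rfl

/-- Every ray cofinal with `1^∞` is in its orbit. -/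
theorem exists_apply_ones_eq {n : ℕ} {x : Ray} (hx : ∀ i, n ≤ i → x i = true) :
    ∃ g ∈ grig, g ones = x := by
  induction n generalizing x with
  | zero =>
    refine ⟨1, one_mem _, ?_⟩
    ext i; exact (hx i (Nat.zero_le i)).symm
  | succ n ih =>
    obtain ⟨i, y, rfl⟩ := exists_cons x
    obtain ⟨g, hg, rfl⟩ := ih (x := y) fun j hj => hx (j + 1) (by omega)
    obtain ⟨h, hh, -, -, h1, -⟩ := exists_lift hg
    have key : h ones = cons true (g ones) := by rw [← h1, cons_true_ones]
    cases i with
    | true => exact ⟨h, hh, key⟩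
    | false => exact ⟨rot * h, mul_mem rot_mem hh, by simp [Perm.mul_apply, key]⟩

/-- The orbit of `1^∞`. -/
def Cofinal (x : Ray) : Prop := ∃ g ∈ grig, g ones = x

theorem Spot.cofinal {n : ℕ} {x : Ray} (h : Spot n x) : Cofinal x := exists_apply_ones_eq h.2

theorem cofinal_ones : Cofinal ones := ⟨1, one_mem _, rfl⟩

theorem Cofinal.exists_apply_eq {x y : Ray} (hx : Cofinal x) (hy : Cofinal y) :
    ∃ g ∈ grig, g x = y := by
  obtain ⟨g, hg, rfl⟩ := hx
  obtain ⟨h, hh, rfl⟩ := hy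
  exact ⟨h * g⁻¹, mul_mem hh (inv_mem hg), by simp [Perm.mul_apply]⟩

/-- The element `(ba)²`, whose conjugates generate a branching subgroup. -/
noncomputable def branchGen : Perm Ray := kdir (true, true) * rot * kdir (true, true) * rot

/-- The subgroup generated by the conjugates of `(ba)²`. -/
noncomputable def branch : Subgroup (Perm Ray) :=
  Subgroup.closure {k | ∃ g ∈ grig, g * branchGen * g⁻¹ = k}

theorem branch_le : branch ≤ grig := by
  refine (Subgroup.closure_le _).2 ?_
  rintro _ ⟨g, hg, rfl⟩
  exact mul_mem (mul_mem hg (mul_mem (mul_mem (mul_mem (kdir_mem _) rot_mem) (kdir_mem _)) rot_mem))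
    (inv_mem hg)

theorem branchGen_mem : branchGen ∈ branch :=
  Subgroup.subset_closure ⟨1, one_mem _, by simp⟩

theorem conj_mem_branch {g k : Perm Ray} (hg : g ∈ grig) (hk : k ∈ branch) :
    g * k * g⁻¹ ∈ branch := by
  induction hk using Subgroup.closure_induction with
  | mem k hk =>
    obtain ⟨h, hh, rfl⟩ := hk
    exact Subgroup.subset_closure ⟨g * h, mul_mem hg hh, by group⟩
  | one => simp
  | mul x y _ _ hx hy =>
    have : g * (x * y) * g⁻¹ = (g * x * g⁻¹) * (g * y * g⁻¹) := by group
    rw [this]; exact mul_mem hx hy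
  | inv x _ hx =>
    have : g * x⁻¹ * g⁻¹ = (g * x * g⁻¹)⁻¹ := by group
    rw [this]; exact inv_mem hx

/-- The commutator of `d^a` and `b` acts as `(ba)²` below the vertex `0` and trivially below `1`. -/
theorem exists_section_branchGen :
    ∃ h ∈ branch, (∀ x, h (cons false x) = cons false (branchGen x)) ∧
      ∀ x, h (cons true x) = cons true x := by
  set b := kdir (true, true) with hb
  set d := kdir (false, true) with hd
  have hbb : b * b = 1 := by rw [hb, kdir_mul]; exact kdir_one
  have hdd : d * d = 1 := by rw [hd, kdir_mul]; exact kdir_one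
  have hdb : d * b = b * d := by rw [hd, hb, kdir_mul, kdir_mul]; rfl
  refine ⟨rot * d * rot * b * (rot * d * rot) * b, ?_, fun x => ?_, fun x => ?_⟩
  -- As `b` and `d` commute, this commutator is a product of conjugates of `(ba)²` and its inverse.
  -- Its sections are `baba` at `0` and `c² = 1` at `1`.
  · have e : rot * d * rot * b * (rot * d * rot) * b =
        ((rot * d) * (branchGen⁻¹) * (rot * d)⁻¹) * (rot * branchGen * rot⁻¹) := by
      have hbi : b⁻¹ = b := kdir_inv _
      have hdi : d⁻¹ = d := kdir_inv _
      rw [branchGen, ← hb]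
      simp only [mul_inv_rev, rot_inv, hbi, hdi]
      have hrr : ∀ g : Perm Ray, rot * (rot * g) = g := fun g => by
        rw [← mul_assoc, rot_mul_rot, one_mul]
      simp only [mul_assoc, hrr]
      have hbb' : ∀ g : Perm Ray, b * (b * g) = g := fun g => by rw [← mul_assoc, hbb, one_mul]
      have hdb' : ∀ g : Perm Ray, b * (d * g) = d * (b * g) := fun g => by
        rw [← mul_assoc, ← hdb, mul_assoc]
      simp only [hbb', hdb', rot_mul_rot, mul_one]
    rw [e]
    exact mul_mem (conj_mem_branch (mul_mem rot_mem (kdir_mem _)) (inv_mem branchGen_mem))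
      (conj_mem_branch rot_mem branchGen_mem)
  · simp [Perm.mul_apply, hb, hd, branchGen, Klein.shift]
  · simp [Perm.mul_apply, hb, hd, Klein.shift]
    have := congrArg (fun g : Perm Ray => g x) (kdir_mul (true, false) (true, false))
    rw [show (kdir (true, false)) ((kdir (true, false)) x) = x by
      simpa [Klein.add, kdir_one, Perm.mul_apply] using this]

/-- The regular branch property. The rotation carries `exists_section_branchGen` below the vertex
`1`, and conjugating by the lifts of `exists_lift` reaches all generators of `branch`. -/
theorem exists_branch_true {k : Perm Ray} (hk : k ∈ branch) :
    ∃ h ∈ branch, (∀ x, h (cons true x) = cons true (k x)) ∧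
      ∀ x, h (cons false x) = cons false x := by
  induction hk using Subgroup.closure_induction with
  | mem k hk =>
    obtain ⟨g, hg, rfl⟩ := hk
    obtain ⟨h, hh, h0, h1⟩ := exists_section_branchGen
    obtain ⟨l, hl, m, -, l1, l0⟩ := exists_lift hg
    have l1' : ∀ x, l⁻¹ (cons true x) = cons true (g⁻¹ x) := fun x => by
      rw [Perm.inv_eq_iff_eq, l1]; simp
    have l0' : ∀ x, l⁻¹ (cons false x) = cons false (m⁻¹ x) := fun x => by
      rw [Perm.inv_eq_iff_eq, l0]; simp
    refine ⟨l * (rot * h * rot⁻¹) * l⁻¹, conj_mem_branch hl (conj_mem_branch rot_mem hh), ?_, ?_⟩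
    · intro x; simp [Perm.mul_apply, l1, l1', h0]
    · intro x; simp [Perm.mul_apply, l0, l0', h1]
  | one => exact ⟨1, one_mem _, fun _ => rfl, fun _ => rfl⟩
  | mul x y _ _ hx hy =>
    obtain ⟨h, hh, h1, h0⟩ := hx
    obtain ⟨k, hk, k1, k0⟩ := hy
    exact ⟨h * k, mul_mem hh hk, by simp [Perm.mul_apply, h1, k1],
      by simp [Perm.mul_apply, h0, k0]⟩
  | inv x _ hx =>
    obtain ⟨h, hh, h1, h0⟩ := hx
    refine ⟨h⁻¹, inv_mem hh, fun y => ?_, fun y => ?_⟩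
    · rw [Perm.inv_eq_iff_eq, h1]; simp
    · rw [Perm.inv_eq_iff_eq, h0]

/-- Both sections of `(ba)²` are a product of `a` and `c`, so the second letter of every ray is
flipped. -/
theorem branchGen_apply_ne (x : Ray) : branchGen x ≠ x := by
  obtain ⟨i, y, rfl⟩ := exists_cons x
  intro h
  cases i
  · simp only [branchGen, Perm.mul_apply, rot_cons, Bool.not_false, kdir_cons_true,
      kdir_cons_false, Bool.not_true, if_true, cons_inj, true_and] at h
    have := congrFun h 0
    simp [kdir] at this
  · simp only [branchGen, Perm.mul_apply, rot_cons, Bool.not_false, kdir_cons_true,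
      kdir_cons_false, Bool.not_true, if_true, cons_inj, true_and] at h
    have := congrFun h 0
    simp [kdir] at this

/-- Rigid stabilisers move every ray: the group is weakly branch. -/
theorem exists_rigid (n : ℕ) (x : Ray) :
    ∃ g ∈ branch, g x ≠ x ∧ ∀ y, (∃ i < n, y i ≠ x i) → g y = y := by
  induction n generalizing x with
  | zero => exact ⟨branchGen, branchGen_mem, branchGen_apply_ne x, by simp⟩
  | succ n ih =>
    obtain ⟨i, x, rfl⟩ := exists_cons x
    obtain ⟨g, hg, hne, hfix⟩ := ih x
    obtain ⟨h, hh, h1, h0⟩ := exists_branch_true hg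
    have key : ∀ y, (∃ j < n + 1, cons true y j ≠ cons true x j) → g y = y := by
      rintro y ⟨j, hj, hjn⟩
      cases j with
      | zero => exact absurd rfl hjn
      | succ j => exact hfix y ⟨j, by omega, hjn⟩
    cases i with
    | true =>
      refine ⟨h, hh, by simpa [h1, cons_inj] using hne, ?_⟩
      intro y hy
      obtain ⟨i, y, rfl⟩ := exists_cons y
      cases i with
      | false => exact h0 y
      | true => rw [h1, key y hy]
    | false =>
      refine ⟨rot * h * rot⁻¹, conj_mem_branch rot_mem hh,
        by simpa [Perm.mul_apply, h1, cons_inj] using hne, ?_⟩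
      intro y hy
      obtain ⟨i, y, rfl⟩ := exists_cons y
      cases i with
      | true => simp [Perm.mul_apply, h0]
      | false =>
        have : g y = y := by
          obtain ⟨j, hj, hjn⟩ := hy
          cases j with
          | zero => exact absurd rfl hjn
          | succ j => exact hfix y ⟨j, by omega, hjn⟩
        simp [Perm.mul_apply, h1, this]

/-- Finitely many rays can be fixed while another one is moved away from them. -/
theorem exists_fix_move {F : Set Ray} (hF : F.Finite) (x : Ray) :
    ∃ g ∈ grig, g x ≠ x ∧ ∀ y ∈ F, y ≠ x → g y = y := by
  -- A long enough prefix separates `x` from the rest of `F`; the rigid stabiliser of that prefix is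
  -- then used.
  have hn : ∃ n, ∀ y ∈ F, y ≠ x → ∃ i < n, y i ≠ x i := by
    induction F, hF using Set.Finite.induction_on with
    | empty => exact ⟨0, by simp⟩
    | @insert a F _ _ ih =>
      obtain ⟨n, hn⟩ := ih
      by_cases hax : a = x
      · refine ⟨n, ?_⟩
        rintro y (rfl | hy) hyx
        · exact absurd hax hyx
        · exact hn y hy hyx
      · obtain ⟨i, hi⟩ := Function.ne_iff.1 hax
        refine ⟨max n (i + 1), ?_⟩
        rintro y (rfl | hy) hyx
        · exact ⟨i, by omega, hi⟩
        · obtain ⟨j, hj, hjn⟩ := hn y hy hyx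
          exact ⟨j, by omega, hjn⟩
  obtain ⟨n, hn⟩ := hn
  obtain ⟨g, hg, hne, hfix⟩ := exists_rigid n x
  exact ⟨g, branch_le hg, hne, fun y hy hyx => hfix y (hn y hy hyx)⟩

end Grig

/-! ### Decorated groups and their independence of initial terms. -/

namespace Grig

open Equiv Function Monomial

open scoped commutatorElement

variable {Z : Type*}

open Classical in
/-- The function on rays with value `b n` at the two rays `1^n 0 * 1^∞`, for `n ≥ N`. -/
noncomputable def decoration (b : ℕ → Perm Z) (N : ℕ) (x : Ray) : Perm Z :=
  if h : ∃ n, N ≤ n ∧ Spot n x then b h.choose else 1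

theorem decoration_of_spot (b : ℕ → Perm Z) {N n : ℕ} {x : Ray} (hn : N ≤ n) (h : Spot n x) :
    decoration b N x = b n := by
  have hex : ∃ n, N ≤ n ∧ Spot n x := ⟨n, hn, h⟩
  rw [decoration, dif_pos hex, hex.choose_spec.2.1.unique h.1]

theorem decoration_of_not (b : ℕ → Perm Z) {N : ℕ} {x : Ray} (h : ∀ n, N ≤ n → ¬ Spot n x) :
    decoration b N x = 1 :=
  dif_neg fun ⟨n, hn, hx⟩ => h n hn hx

theorem exists_of_decoration_ne (b : ℕ → Perm Z) {N : ℕ} {x : Ray} (h : decoration b N x ≠ 1) :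
    ∃ n, N ≤ n ∧ Spot n x := by
  by_contra hc
  exact h (decoration_of_not b fun n hn hx => hc ⟨n, hn, hx⟩)

/-- The ray `1^n 0 i 1^∞`. -/
def spotRay (n : ℕ) (i : Bool) : Ray := fun j =>
  if j = n then false else if j = n + 1 then i else true

theorem spot_spotRay (n : ℕ) (i : Bool) : Spot n (spotRay n i) := by
  refine ⟨⟨fun j hj => ?_, ?_⟩, fun j hj => ?_⟩
  · rw [spotRay, if_neg (by omega), if_neg (by omega)]
  · simp [spotRay]
  · rw [spotRay, if_neg (by omega), if_neg (by omega)]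

theorem Spot.eq_spotRay {n : ℕ} {x : Ray} (h : Spot n x) : x = spotRay n (x (n + 1)) := by
  ext j
  unfold spotRay
  split_ifs with h1 h2
  · rw [h1, h.1.2]
  · rw [h2]
  · rcases lt_or_ge j n with hj | hj
    · exact h.1.1 j hj
    · exact h.2 j (by omega)

theorem spotRay_ne (n : ℕ) : spotRay n false ≠ spotRay n true := by
  intro h
  have := congrFun h (n + 1)
  simp [spotRay] at this

theorem finite_spot (n : ℕ) : {x | Spot n x}.Finite :=
  (Set.finite_range (spotRay n)).subset fun _ hx => ⟨_, (Spot.eq_spotRay hx).symm⟩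

/-- Commutators of translates of a decoration have finite support. -/
theorem finite_commutator_support (b : ℕ → Perm Z) (N : ℕ) {g h : Perm Ray} (hg : g ∈ grig)
    (hh : h ∈ grig) :
    {y | ⁅decoration b N (g⁻¹ y), decoration b N (h⁻¹ y)⁆ ≠ 1}.Finite := by
  obtain ⟨r, hr⟩ := exists_near_bound (mul_mem (inv_mem hh) hg)
  have hfin : (⋃ n ∈ Set.Iio (r + 1), {x | Spot n x}).Finite :=
    (Set.finite_Iio _).biUnion fun n _ => finite_spot n
  refine (hfin.image g).subset fun y hy => ?_
  refine ⟨g⁻¹ y, ?_, by simp⟩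
  obtain ⟨n, hn, hsn⟩ := exists_of_decoration_ne b (N := N) (x := g⁻¹ y) (by
    intro h1; exact hy (by rw [h1, commutatorElement_one_left]))
  obtain ⟨m, hm, hsm⟩ := exists_of_decoration_ne b (N := N) (x := h⁻¹ y) (by
    intro h1; exact hy (by rw [h1, commutatorElement_one_right]))
  simp only [Set.mem_iUnion]
  refine ⟨n, ?_, hsn⟩
  by_contra hc
  have hc' : r + 1 ≤ n := by simpa using hc
  -- The element `h⁻¹ * g` takes spot `n` to spot `m`. For `n > r` this forces `m = n`, so the two
  -- values coincide and commute.
  have h1 := hr n 0 _ (by omega) (spot_iff_near.1 hsn)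
  rw [show (h⁻¹ * g) (g⁻¹ y) = h⁻¹ y by simp [Perm.mul_apply]] at h1
  have h2 := h1.eq_of_spot (by omega) hsm
  apply hy
  rw [decoration_of_spot b hn hsn, decoration_of_spot b hm hsm, h2, commutatorElement_self]

/-- The group generated by the Grigorchuk group and a decoration. -/
noncomputable def decorated (b : ℕ → Perm Z) (N : ℕ) : Subgroup (Perm (Ray × Z)) :=
  Subgroup.closure (insert (base (decoration b N)) (top '' insert rot (Set.range kdir)))

theorem top_mem (b : ℕ → Perm Z) (N : ℕ) {g : Perm Ray} (hg : g ∈ grig) :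
    (top g : Perm (Ray × Z)) ∈ decorated b N := by
  have : (grig.map top : Subgroup (Perm (Ray × Z))) ≤ decorated b N := by
    rw [grig, MonoidHom.map_closure]
    exact Subgroup.closure_mono (Set.subset_insert _ _)
  exact this ⟨g, hg, rfl⟩

theorem base_decoration_mem (b : ℕ → Perm Z) (N : ℕ) :
    base (decoration b N) ∈ decorated b N :=
  Subgroup.subset_closure (Set.mem_insert _ _)

theorem translate_mem {b : ℕ → Perm Z} {N : ℕ} {g : Perm Ray} (hg : g ∈ grig)
    {φ : Ray → Perm Z} (hφ : base φ ∈ decorated b N) :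
    base (fun x => φ (g⁻¹ x)) ∈ decorated b N := by
  rw [← top_mul_base_mul_inv]
  exact mul_mem (mul_mem (top_mem b N hg) hφ) (inv_mem (top_mem b N hg))

/-- The group generated by commutators of the late terms of `b`. -/
def lateCommutators (b : ℕ → Perm Z) (N : ℕ) : Subgroup (Perm Z) :=
  Subgroup.closure {c | ∃ i ≥ N, ∃ j ≥ N, ⁅b i, b j⁆ = c}

/-- Each late commutator is the value at a given ray of a finitely supported function. -/
theorem exists_finite_support {b : ℕ → Perm Z} {N : ℕ} {c : Perm Z}
    (hc : c ∈ lateCommutators b N) {x : Ray} (hx : Cofinal x) :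
    ∃ φ : Ray → Perm Z, φ x = c ∧ {y | φ y ≠ 1}.Finite ∧ base φ ∈ decorated b N := by
  induction hc using Subgroup.closure_induction with
  | mem c hc =>
    obtain ⟨i, hi, j, hj, rfl⟩ := hc
    obtain ⟨g, hg, hgx⟩ := (spot_spotRay i true).cofinal.exists_apply_eq hx
    obtain ⟨h, hh, hhx⟩ := (spot_spotRay j true).cofinal.exists_apply_eq hx
    -- The translates bring spots `i` and `j` to the same ray `x`.
    refine ⟨⁅fun y => decoration b N (g⁻¹ y), fun y => decoration b N (h⁻¹ y)⁆, ?_, ?_, ?_⟩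
    · change ⁅decoration b N (g⁻¹ x), decoration b N (h⁻¹ x)⁆ = _
      rw [Perm.inv_eq_iff_eq.2 hgx.symm, Perm.inv_eq_iff_eq.2 hhx.symm,
        decoration_of_spot b hi (spot_spotRay i true),
        decoration_of_spot b hj (spot_spotRay j true)]
    · exact finite_commutator_support b N hg hh
    · rw [map_commutatorElement, commutatorElement_def]
      have h1 := translate_mem hg (base_decoration_mem b N)
      have h2 := translate_mem hh (base_decoration_mem b N)
      exact mul_mem (mul_mem (mul_mem h1 h2) (inv_mem h1)) (inv_mem h2)
  | one => exact ⟨1, rfl, by simp, by simp⟩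
  | mul c d _ _ hc hd =>
    obtain ⟨φ, rfl, h1, h2⟩ := hc
    obtain ⟨χ, rfl, h3, h4⟩ := hd
    refine ⟨φ * χ, rfl, (h1.union h3).subset fun y hy => ?_, by
      rw [map_mul]; exact mul_mem h2 h4⟩
    by_contra hn
    simp only [Set.mem_union, Set.mem_ofPred_eq, not_or, not_not] at hn
    exact hy (by simp [hn.1, hn.2])
  | inv c _ hc =>
    obtain ⟨φ, rfl, h1, h2⟩ := hc
    exact ⟨φ⁻¹, rfl, by simpa using h1, by rw [map_inv]; exact inv_mem h2⟩

/-- Commutators of late commutators can be realised at a single ray. -/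
theorem single_commutator_mem {b : ℕ → Perm Z} {N : ℕ} {c d : Perm Z}
    (hc : c ∈ lateCommutators b N) (hd : d ∈ lateCommutators b N) {x : Ray} (hx : Cofinal x) :
    base (Pi.mulSingle x ⁅c, d⁆) ∈ decorated b N := by
  obtain ⟨φ, rfl, hφ, hφm⟩ := exists_finite_support hc hx
  obtain ⟨χ, rfl, hχ, hχm⟩ := exists_finite_support hd hx
  -- Dividing `φ` by its translate under `g` keeps its value at `x` and kills it on the rest of the
  -- support of `χ`, so the commutator with `χ` lives at `x` alone.
  obtain ⟨g, hg, hgx, hfix⟩ := exists_fix_move (hφ.union hχ) x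
  have hgx' : g⁻¹ x ≠ x := fun h => hgx (Perm.inv_eq_iff_eq.1 h).symm
  have hout : φ (g⁻¹ x) = 1 := by
    by_contra hc
    have := hfix (g⁻¹ x) (Or.inl hc) hgx'
    exact hgx' (this.symm.trans (by simp))
  set ψ : Ray → Perm Z := φ * (fun y => φ (g⁻¹ y))⁻¹ with hψ
  have hψm : base ψ ∈ decorated b N := by
    rw [hψ, map_mul, map_inv]; exact mul_mem hφm (inv_mem (translate_mem hg hφm))
  have key : (Pi.mulSingle x ⁅φ x, χ x⁆ : Ray → Perm Z) = ⁅ψ, χ⁆ := by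
    ext1 y
    change _ = ⁅ψ y, χ y⁆
    by_cases hy : y = x
    · subst hy
      rw [Pi.mulSingle_eq_same]
      have : ψ y = φ y := by
        change φ y * (φ (g⁻¹ y))⁻¹ = _
        rw [hout, inv_one, mul_one]
      rw [this]
    · rw [Pi.mulSingle_eq_of_ne hy]
      by_cases hyχ : χ y = 1
      · rw [hyχ, commutatorElement_one_right]
      · have h1 : g⁻¹ y = y := by
          rw [Perm.inv_eq_iff_eq, hfix y (Or.inr hyχ) hy]
        have : ψ y = 1 := by
          change φ y * (φ (g⁻¹ y))⁻¹ = _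
          rw [h1, mul_inv_cancel]
        rw [this, commutatorElement_one_left]
  rw [key, map_commutatorElement, commutatorElement_def]
  exact mul_mem (mul_mem (mul_mem hψm hχm) (inv_mem hψm)) (inv_mem hχm)

/-- The sequence `b` generates, with any number of initial terms left out, the same perfect
group. -/
def Recurrent (b : ℕ → Perm Z) : Prop := ∀ N n, b n ∈ lateCommutators b N

/-- A generator `⁅b i, b j⁆` is by recurrence a commutator of two elements of `lateCommutators b N`,
which is the case covered by `single_commutator_mem`. -/
theorem Recurrent.single_mem {b : ℕ → Perm Z} (hb : Recurrent b) (N : ℕ) {c : Perm Z}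
    (hc : c ∈ lateCommutators b 0) {x : Ray} (hx : Cofinal x) :
    base (Pi.mulSingle x c) ∈ decorated b N := by
  have : lateCommutators b 0 ≤
      (decorated b N).comap (base.comp (MonoidHom.mulSingle (fun _ : Ray => Perm Z) x)) := by
    refine (Subgroup.closure_le _).2 ?_
    rintro _ ⟨i, -, j, -, rfl⟩
    exact single_commutator_mem (hb N i) (hb N j) hx
  exact this hc

theorem decoration_succ (b : ℕ → Perm Z) (N : ℕ) :
    decoration b N = decoration b (N + 1) * Pi.mulSingle (spotRay N false) (b N) *
      Pi.mulSingle (spotRay N true) (b N) := by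
  ext1 x
  simp only [Pi.mul_apply]
  by_cases hx : Spot N x
  · have h1 : decoration b (N + 1) x = 1 := decoration_of_not b fun n hn hs => by
      have := hs.1.unique hx.1; omega
    rw [decoration_of_spot b le_rfl hx, h1]
    have h2 := hx.eq_spotRay
    cases hi : x (N + 1) <;> rw [hi] at h2 <;> subst h2
    · rw [Pi.mulSingle_eq_same, Pi.mulSingle_eq_of_ne (spotRay_ne N)]; simp
    · rw [Pi.mulSingle_eq_same, Pi.mulSingle_eq_of_ne (spotRay_ne N).symm]; simp
  · rw [Pi.mulSingle_eq_of_ne (by rintro rfl; exact hx (spot_spotRay _ _)),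
      Pi.mulSingle_eq_of_ne (by rintro rfl; exact hx (spot_spotRay _ _)), mul_one, mul_one]
    by_cases h : ∃ n, N ≤ n ∧ Spot n x
    · obtain ⟨n, hn, hs⟩ := h
      have : N + 1 ≤ n := by
        rcases hn.lt_or_eq with h | rfl
        · exact h
        · exact absurd hs hx
      rw [decoration_of_spot b hn hs, decoration_of_spot b this hs]
    · rw [decoration_of_not b fun n hn hs => h ⟨n, hn, hs⟩,
        decoration_of_not b fun n hn hs => h ⟨n, by omega, hs⟩]

/-- Leaving out initial terms of the decoration does not change the group. -/
theorem Recurrent.decorated_eq {b : ℕ → Perm Z} (hb : Recurrent b) (N : ℕ) :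
    decorated b N = decorated b 0 := by
  induction N with
  | zero => rfl
  | succ N ih =>
    rw [← ih]
    have hs : ∀ M i, base (Pi.mulSingle (spotRay N i) (b N)) ∈ decorated b M := fun M i =>
      hb.single_mem M (hb 0 N) (spot_spotRay N i).cofinal
    have key : base (decoration b N) = base (decoration b (N + 1)) *
        base (Pi.mulSingle (spotRay N false) (b N)) *
          base (Pi.mulSingle (spotRay N true) (b N)) := by
      rw [← map_mul, ← map_mul, ← decoration_succ]
    have htop : ∀ M, top '' insert rot (Set.range kdir) ⊆
        (decorated b M : Set (Perm (Ray × Z))) := fun M =>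
       (Set.subset_insert _ _).trans Subgroup.subset_closure
    apply le_antisymm
    · refine (Subgroup.closure_le _).2 (Set.insert_subset ?_ (htop N))
      have : base (decoration b (N + 1)) = base (decoration b N) *
          (base (Pi.mulSingle (spotRay N true) (b N)))⁻¹ *
            (base (Pi.mulSingle (spotRay N false) (b N)))⁻¹ := by
        rw [key]; group
      rw [this]
      exact mul_mem (mul_mem (base_decoration_mem b N) (inv_mem (hs N _))) (inv_mem (hs N _))
    · refine (Subgroup.closure_le _).2 (Set.insert_subset ?_ (htop (N + 1)))
      rw [key]
      exact mul_mem (mul_mem (base_decoration_mem b (N + 1)) (hs _ _)) (hs _ _)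

end Grig

/-! ### Words, and comparison of a decorated group with its local model. -/

namespace Grig

open Equiv Function Monomial

variable {Z : Type*}

/-- The letters of the words we consider: `none` is the rooted generator, and `some (v, k)` is the
product of a directed generator and a power of a fibrewise one. -/
abbrev Letter := Option (Klein × ℤ)

/-- The action of a letter on rays. -/
noncomputable def Letter.act : Letter → Perm Ray
  | none => rot
  | some (v, _) => kdir v

/-- The value of a letter, for a given fibrewise permutation. -/
noncomputable def Letter.value (φ : Ray → Perm Z) : Letter → Perm (Ray × Z)
  | none => top rot
  | some (v, k) => top (kdir v) * base φ ^ k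

/-- The action of a word on rays. -/
noncomputable def wordAct (w : List Letter) : Perm Ray := (w.map Letter.act).prod

/-- The value of a word. -/
noncomputable def wordValue (φ : Ray → Perm Z) (w : List Letter) : Perm (Ray × Z) :=
  (w.map (Letter.value φ)).prod

@[simp] theorem wordAct_cons (l : Letter) (w : List Letter) (x : Ray) :
    wordAct (l :: w) x = l.act (wordAct w x) := by
  simp [wordAct, Perm.mul_apply]

@[simp] theorem wordValue_cons (φ : Ray → Perm Z) (l : Letter) (w : List Letter) (p : Ray × Z) :
    wordValue φ (l :: w) p = l.value φ (wordValue φ w p) := by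
  simp [wordValue, Perm.mul_apply]

theorem base_zpow_apply (φ : Ray → Perm Z) (k : ℤ) (p : Ray × Z) :
    (base φ ^ k) p = (p.1, (φ p.1 ^ k) p.2) := by
  rw [← map_zpow]; rfl

theorem Letter.value_some_apply (φ : Ray → Perm Z) (v : Klein) (k : ℤ) (p : Ray × Z) :
    Letter.value φ (some (v, k)) p = (kdir v p.1, (φ p.1 ^ k) p.2) := by
  rw [Letter.value, Perm.mul_apply, base_zpow_apply]; rfl

theorem Letter.value_fst (φ : Ray → Perm Z) (l : Letter) (p : Ray × Z) :
    (l.value φ p).1 = l.act p.1 := by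
  rcases l with _ | ⟨v, k⟩
  · rfl
  · rw [Letter.value_some_apply]; rfl

theorem wordValue_fst (φ : Ray → Perm Z) (w : List Letter) (p : Ray × Z) :
    (wordValue φ w p).1 = wordAct w p.1 := by
  induction w with
  | nil => rfl
  | cons l w ih => rw [wordValue_cons, Letter.value_fst, ih, wordAct_cons]

theorem Near.act {n s : ℕ} {x : Ray} (h : Near n s x) (hs : s < n) (l : Letter) :
    Near n (s + 1) (l.act x) := by
  rcases l with _ | ⟨v, k⟩
  · exact h.rot hs
  · exact h.dir hs _

theorem Letter.act_act (l : Letter) (x : Ray) : l.act (l.act x) = x := by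
  rcases l with _ | ⟨v, k⟩
  · exact flipFun_involutive x
  · exact dirFun_involutive _ x

/-- Letters act on rays as involutions, so the word can be run backwards. -/
theorem Near.of_wordAct {n s : ℕ} {x : Ray} {w : List Letter} (h : Near n s (wordAct w x))
    (hs : s + w.length ≤ n) : Near n (s + w.length) x := by
  induction w generalizing s with
  | nil => exact h
  | cons l w ih =>
    rw [wordAct_cons] at h
    rw [List.length_cons] at hs ⊢
    have h1 := h.act (by omega) l
    rw [Letter.act_act] at h1
    have := ih h1 (by omega)
    rwa [add_assoc, add_comm 1] at this

/-- The translation by `1` in the fibre over `1^∞`, the local model of a decoration. -/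
noncomputable def modelDecoration (m : ℕ) : Ray → Perm (ZMod m) :=
  Pi.mulSingle ones (Equiv.addRight 1)

theorem modelDecoration_ones_zpow (m : ℕ) (k : ℤ) (q : ZMod m) :
    (modelDecoration m ones ^ k) q = q + k := by
  rw [modelDecoration, Pi.mulSingle_eq_same]
  induction k using Int.induction_on generalizing q with
  | zero => simp
  | succ k ih =>
    rw [zpow_add_one, Perm.mul_apply, ih]
    push_cast
    simp only [Equiv.coe_addRight]
    ring
  | pred k ih =>
    rw [zpow_sub_one, Perm.mul_apply, ih]
    push_cast
    have : (Equiv.addRight (1 : ZMod m))⁻¹ q = q - 1 := by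
      rw [Perm.inv_eq_iff_eq]; simp
    rw [this]
    ring

/-- Near a spot, a decoration acts as its local model does. -/
theorem wordValue_near (b : ℕ → Perm Z) (m : ℕ) {N n s : ℕ} (hN : N ≤ n) {x : Ray}
    (hx : Near n s x) (w : List Letter) (hs : s + w.length ≤ n) :
    Near n (s + w.length) (wordAct w x) ∧ ∃ k : ℤ,
      (∀ z, wordValue (decoration b N) w (x, z) = (wordAct w x, (b n ^ k) z)) ∧
      ∀ q, wordValue (modelDecoration m) w (trunc n x, q) = (trunc n (wordAct w x), q + k) := by
  induction w with
  | nil => exact ⟨hx, 0, fun z => rfl, fun q => by simp [wordValue, wordAct]⟩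
  | cons l w ih =>
    rw [List.length_cons] at hs
    obtain ⟨hy, k, hk, hq⟩ := ih (by omega)
    refine ⟨by rw [wordAct_cons]; exact hy.act (by omega) l, ?_⟩
    set y := wordAct w x with hydef
    rcases l with _ | ⟨v, j⟩
    · refine ⟨k, fun z => ?_, fun q => ?_⟩
      · rw [wordValue_cons, hk, wordAct_cons]; rfl
      · rw [wordValue_cons, hq, wordAct_cons, ← hydef]
        change (rot (trunc n y), _) = (trunc n (rot y), _)
        rw [trunc_rot (by omega)]
    · have htr : trunc n (kdir v y) = kdir v (trunc n y) := hy.trunc_dir (by omega) _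
      -- The decoration acts at `y` exactly when the model decoration acts at the truncation; both
      -- then count the exponent `j`.
      by_cases h1 : trunc n y = ones
      · have hd := decoration_of_spot b hN (hy.spot_iff_trunc.2 h1)
        refine ⟨j + k, fun z => ?_, fun q => ?_⟩
        · rw [wordValue_cons, hk, wordAct_cons, Letter.value_some_apply, zpow_add]
          simp only [hd]; rfl
        · rw [wordValue_cons, hq, wordAct_cons, Letter.value_some_apply, ← hydef]
          change _ = (trunc n (kdir v y), _)
          rw [htr]
          simp only [h1, modelDecoration_ones_zpow]
          push_cast; rw [add_comm (j : ZMod m), add_assoc]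
      · have hd : decoration b N y = 1 := decoration_of_not b fun i _ hsi => by
          have := hy.eq_of_spot (by omega) hsi
          subst this
          exact h1 (hy.spot_iff_trunc.1 hsi)
        refine ⟨k, fun z => ?_, fun q => ?_⟩
        · rw [wordValue_cons, hk, wordAct_cons, Letter.value_some_apply]
          simp only [hd, one_zpow]; rfl
        · rw [wordValue_cons, hq, wordAct_cons, Letter.value_some_apply, ← hydef]
          change _ = (trunc n (kdir v y), _)
          have : modelDecoration m (trunc n y) = 1 := Pi.mulSingle_eq_of_ne h1 _
          rw [htr]
          simp only [this, one_zpow]; rfl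

/-- Far from all spots, a decoration is not seen. -/
theorem wordValue_far (b : ℕ → Perm Z) {N R : ℕ} (hR : R ≤ N) {x : Ray}
    (hx : ∀ n, N ≤ n → ¬ Near n R x) (w : List Letter) (hw : w.length ≤ R) (z : Z) :
    wordValue (decoration b N) w (x, z) = (wordAct w x, z) := by
  induction w with
  | nil => rfl
  | cons l w ih =>
    rw [List.length_cons] at hw
    rw [wordValue_cons, ih (by omega), wordAct_cons]
    rcases l with _ | ⟨v, j⟩
    · rfl
    · have hd : decoration b N (wordAct w x) = 1 := decoration_of_not b fun n hn hs => by
        refine hx n hn ?_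
        have := (spot_iff_near.1 hs).of_wordAct (by omega)
        exact this.mono (by omega)
      rw [Letter.value_some_apply]
      simp only [hd, one_zpow]; rfl

/-- Short words with the same value in the local model have the same value. -/
theorem wordValue_eq_of_model (b : ℕ → Perm Z) {m : ℕ} (hb : ∀ n, b n ^ m = 1) {N R : ℕ}
    (hR : 2 * R ≤ N) {w w' : List Letter} (hw : w.length ≤ R) (hw' : w'.length ≤ R)
    (h : wordValue (modelDecoration m) w = wordValue (modelDecoration m) w') :
    wordValue (decoration b N) w = wordValue (decoration b N) w' := by
  have hact : ∀ x, wordAct w x = wordAct w' x := fun x => by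
    have h1 := wordValue_fst (modelDecoration m) w (x, 0)
    rw [h, wordValue_fst] at h1
    exact h1.symm
  ext1 ⟨x, z⟩
  by_cases hx : ∃ n, N ≤ n ∧ Near n R x
  · obtain ⟨n, hn, hx⟩ := hx
    -- Starting from nearness `R`, at most `R` further letters need `2 * R ≤ n`; this is the source
    -- of the factor `2`.
    obtain ⟨-, k, hk, hq⟩ := wordValue_near b m hn hx w (by omega)
    obtain ⟨-, k', hk', hq'⟩ := wordValue_near b m hn hx w' (by omega)
    rw [hk, hk', hact]
    have h1 := (hq 0).symm.trans ((congrArg (· (trunc n x, 0)) h).trans (hq' 0))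
    have h2 : (k : ZMod m) = k' := by simpa using congrArg Prod.snd h1
    -- The model only knows the exponent modulo `m`, which suffices because `b n ^ m = 1`.
    have h3 : b n ^ k = b n ^ k' := by
      obtain ⟨c, hc⟩ := (ZMod.intCast_eq_intCast_iff_dvd_sub _ _ _).1 h2
      rw [show k' = k + m * c by linarith, zpow_add, zpow_mul, zpow_natCast, hb, one_zpow, mul_one]
    rw [h3]
  · have hx' : ∀ n, N ≤ n → ¬ Near n R x := fun n hn hc => hx ⟨n, hn, hc⟩
    rw [wordValue_far b (by omega) hx' w hw, wordValue_far b (by omega) hx' w' hw', hact]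

end Grig

/-! ### Wreath recursion and contracting weights in the local model. -/

namespace Grig

open Equiv Function Monomial

variable {A : Type*}

/-- Splitting off the first letter of a ray, over a fibre. -/
def consProdEquiv : Bool × (Ray × A) ≃ Ray × A where
  toFun p := (cons p.1 p.2.1, p.2.2)
  invFun p := (p.1 0, (fun n => p.1 (n + 1), p.2))
  left_inv _ := rfl
  right_inv p := Prod.ext (cons_head_tail p.1) rfl

/-- The permutation acting on the two subtrees by `p`, and on the first letter by `ε`. -/
def join (ε : Bool) (p : Bool → Perm (Ray × A)) : Perm (Ray × A) :=
  consProdEquiv.permCongr (top (Bool.involutive_not.toPerm ^ ε.toNat) * base p)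

theorem join_apply (ε : Bool) (p : Bool → Perm (Ray × A)) (i : Bool) (y : Ray) (c : A) :
    join ε p (cons i y, c) = (cons (xor i ε) (p i (y, c)).1, (p i (y, c)).2) := by
  cases ε <;> cases i <;> rfl

theorem ext_cons {g h : Perm (Ray × A)} (H : ∀ i y c, g (cons i y, c) = h (cons i y, c)) :
    g = h := by
  ext1 ⟨x, c⟩
  obtain ⟨i, y, rfl⟩ := exists_cons x
  exact H i y c

theorem join_mul_join (ε ε' : Bool) (p p' : Bool → Perm (Ray × A)) :
    join ε p * join ε' p' = join (xor ε ε') (fun i => p (xor i ε') * p' i) := by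
  refine ext_cons fun i y c => ?_
  rw [Perm.mul_apply, join_apply, join_apply, join_apply]
  cases i <;> cases ε <;> cases ε' <;> rfl

theorem top_rot_eq_join : (top rot : Perm (Ray × A)) = join true fun _ => 1 := by
  refine ext_cons fun i y c => ?_
  rw [join_apply]; cases i <;> rfl

section Model

variable {m : ℕ}

/-- The letters of the local model of a decorated group. -/
noncomputable def modelLetter (v : Klein) (k : ZMod m) : Perm (Ray × ZMod m) :=
  top (kdir v) * base (Pi.mulSingle ones (Equiv.addRight k))

theorem modelLetter_apply (v : Klein) (k : ZMod m) (x : Ray) (c : ZMod m) :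
    modelLetter v k (x, c) = (kdir v x, if x = ones then c + k else c) := by
  rw [modelLetter, Perm.mul_apply, base_apply, top_apply]
  by_cases h : x = ones
  · subst h; simp
  · simp only [Pi.mulSingle_eq_of_ne h, if_neg h]; rfl

theorem value_modelDecoration (v : Klein) (k : ℤ) :
    Letter.value (modelDecoration m) (some (v, k)) = modelLetter v (k : ZMod m) := by
  ext1 ⟨x, c⟩
  rw [Letter.value_some_apply, modelLetter_apply]
  by_cases h : x = ones
  · subst h; simp [modelDecoration_ones_zpow]
  · have : modelDecoration m x = 1 := Pi.mulSingle_eq_of_ne h _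
    simp [this, h]

theorem kdir_eq_ones (v : Klein) (x : Ray) : kdir v x = ones ↔ x = ones := by
  constructor
  · intro h
    have := congrArg (kdir v) h
    rw [kdir_ones] at this
    rw [← this]
    exact (dirFun_involutive _ x).symm
  · rintro rfl; exact kdir_ones v

theorem modelLetter_mul (v w : Klein) (k l : ZMod m) :
    modelLetter v k * modelLetter w l = modelLetter (v.add w) (k + l) := by
  ext1 ⟨x, c⟩
  rw [Perm.mul_apply, modelLetter_apply, modelLetter_apply, modelLetter_apply, ← kdir_mul]
  by_cases h : x = ones
  · simp [h, Perm.mul_apply, kdir_ones, add_assoc, add_comm k l]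
  · simp [h, Perm.mul_apply, kdir_eq_ones]

theorem modelLetter_zero : modelLetter (false, false) (0 : ZMod m) = 1 := by
  ext1 ⟨x, c⟩
  rw [modelLetter_apply, kdir_one]; simp

theorem cons_true_eq_ones {x : Ray} : cons true x = ones ↔ x = ones := by
  conv_lhs => rw [← cons_true_ones, cons_inj]
  simp

theorem cons_false_ne_ones (x : Ray) : cons false x ≠ ones := by
  rw [← cons_true_ones, Ne, cons_inj]; simp

/-- The fibre translation sits over `1^∞`, so it passes unchanged to the section at `1`: the model
is self-similar. -/
theorem modelLetter_eq_join (v : Klein) (k : ZMod m) :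
    modelLetter v k = join false fun i =>
      if i then modelLetter v.shift k else if v.1 then top rot else 1 := by
  refine ext_cons fun i y c => ?_
  rw [join_apply, modelLetter_apply]
  cases i
  · rw [if_neg (cons_false_ne_ones y), kdir_cons_false]
    cases v.1 <;> rfl
  · simp only [cons_true_eq_ones, kdir_cons_true, if_true]
    rw [modelLetter_apply]; rfl

/-- The weight of a letter of the local model. -/
noncomputable def weight (η : ℝ) (v : Klein) (k : ZMod m) : ℝ :=
  -- The weights of `b`, `c`, `d`; the rooted generator will cost `1 - η ^ 3`. A bare fibre
  -- translation is charged like `d`.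
  match v with
  | (true, true) => η ^ 3
  | (true, false) => 1 - η ^ 2
  | (false, true) => 1 - η
  | (false, false) => if k = 0 then 0 else 1 - η

/-- The constraints on the contraction coefficient. -/
structure IsContraction (η : ℝ) : Prop where
  pos : 0 < η
  lt_one : η < 1
  cubic : η ^ 3 + η ^ 2 + η = 2

variable {η : ℝ}

theorem IsContraction.sq_le (h : IsContraction η) : η ^ 2 ≤ η := by
  have := h.pos; have := h.lt_one; nlinarith

theorem IsContraction.cube_le (h : IsContraction η) : η ^ 3 ≤ η ^ 2 := by
  have := h.pos; have := h.lt_one; nlinarith [sq_nonneg η]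

theorem weight_nonneg (h : IsContraction η) (v : Klein) (k : ZMod m) : 0 ≤ weight η v k := by
  have h1 := h.pos; have h2 := h.lt_one; have h3 := h.sq_le
  rcases v with ⟨_ | _, _ | _⟩ <;> simp only [weight]
  · split_ifs <;> linarith
  · linarith
  · linarith
  · positivity

theorem weight_le_one (h : IsContraction η) (v : Klein) (k : ZMod m) : weight η v k ≤ 1 := by
  have h1 := h.pos; have h2 := h.lt_one; have h3 := h.sq_le; have h4 := h.cube_le
  rcases v with ⟨_ | _, _ | _⟩ <;> simp only [weight]
  · split_ifs <;> linarith
  · linarith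
  · nlinarith
  · linarith

/-- The critical case is `cd = b`, where the cubic relation gives equality if no fibre part
intervenes. It allows adjacent letters to be merged. -/
theorem weight_add_le (h : IsContraction η) (v w : Klein) (k l : ZMod m) :
    weight η (v.add w) (k + l) ≤ weight η v k + weight η w l := by
  have h1 := h.pos; have h2 := h.lt_one; have h3 := h.sq_le; have h4 := h.cube_le
  have h5 := h.cubic
  rcases v with ⟨_ | _, _ | _⟩ <;> rcases w with ⟨_ | _, _ | _⟩ <;>
    simp only [weight, Klein.add, Bool.xor_false, Bool.xor_true, Bool.not_true, Bool.not_false]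
  · by_cases hk : k = 0
    · simp [hk]
    · rw [if_neg hk]; split_ifs <;> linarith
  all_goals (try split_ifs) <;> linarith

/-- A directed letter together with one rooted letter contracts by `η` on passing to sections. For
`b`, `c`, `d` the cubic relation makes this an equality. -/
theorem weight_shift_le (h : IsContraction η) (v : Klein) (k : ZMod m) :
    (if v.1 then 1 - η ^ 3 else 0) + weight η v.shift k ≤ η * (1 - η ^ 3 + weight η v k) := by
  have h1 := h.pos; have h2 := h.lt_one; have h3 := h.sq_le; have h4 := h.cube_le
  have h5 := h.cubic
  have h6 : η ^ 3 = 2 - η - η ^ 2 := by linarith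
  rcases v with ⟨_ | _, _ | _⟩ <;>
    simp only [weight, Klein.shift, Bool.xor_false, Bool.xor_true, Bool.not_true, Bool.not_false,
      if_true, Bool.false_eq_true, if_false]
  · split_ifs
    · nlinarith
    · have : η * (1 - η ^ 3 + (1 - η)) = η ^ 3 := by linear_combination -η * h5
      linarith
  · have : η * (1 - η ^ 3 + (1 - η)) = η ^ 3 := by linear_combination -η * h5
    linarith
  · have : η * (1 - η ^ 3 + (1 - η ^ 2)) = η ^ 2 := by rw [h6]; ring
    linarith
  · have : η * (1 - η ^ 3 + η ^ 3) = η := by ring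
    linarith

/-- `HasWeight η g t` says that `g` is the value of an alternating word of weight `t`. -/
inductive HasWeight (η : ℝ) : Perm (Ray × ZMod m) → ℝ → Prop
  | letter (v : Klein) (k : ZMod m) : HasWeight η (modelLetter v k) (weight η v k)
  | cons (v : Klein) (k : ZMod m) {g : Perm (Ray × ZMod m)} {t : ℝ} (h : HasWeight η g t) :
      HasWeight η (modelLetter v k * (top rot * g)) (weight η v k + (1 - η ^ 3 + t))

theorem HasWeight.nonneg (h : IsContraction η) {g : Perm (Ray × ZMod m)} {t : ℝ}
    (hg : HasWeight η g t) : 0 ≤ t := by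
  have h1 := h.sq_le; have h2 := h.cube_le; have h3 := h.lt_one
  induction hg with
  | letter v k => exact weight_nonneg h v k
  | cons v k _ ih => have := weight_nonneg h v k; linarith

theorem hasWeight_one : HasWeight η (1 : Perm (Ray × ZMod m)) 0 := by
  have := HasWeight.letter (m := m) (η := η) (false, false) 0
  rw [modelLetter_zero] at this
  simpa [weight] using this

theorem HasWeight.rot_mul {g : Perm (Ray × ZMod m)} {t : ℝ} (hg : HasWeight η g t) :
    HasWeight η (top rot * g) (1 - η ^ 3 + t) := by
  have := HasWeight.cons (m := m) (η := η) (false, false) 0 hg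
  rw [modelLetter_zero, one_mul] at this
  simpa [weight] using this

theorem HasWeight.letter_mul (h : IsContraction η) {g : Perm (Ray × ZMod m)} {t : ℝ}
    (hg : HasWeight η g t) (v : Klein) (k : ZMod m) :
    ∃ s ≤ weight η v k + t, HasWeight η (modelLetter v k * g) s := by
  cases hg with
  | letter w l =>
    exact ⟨_, weight_add_le h v w k l, by rw [modelLetter_mul]; exact .letter _ _⟩
  | @cons w l g t hg =>
    refine ⟨weight η (v.add w) (k + l) + (1 - η ^ 3 + t), ?_, ?_⟩
    · have := weight_add_le h v w k l; linarith
    · rw [← mul_assoc, modelLetter_mul]; exact .cons _ _ hg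

/-- The sections of an element have smaller total weight. -/
theorem HasWeight.exists_join (h : IsContraction η) {g : Perm (Ray × ZMod m)} {t : ℝ}
    (hg : HasWeight η g t) : ∃ (ε : Bool) (p : Bool → Perm (Ray × ZMod m)) (s : Bool → ℝ),
      g = join ε p ∧ (∀ i, HasWeight η (p i) (s i)) ∧
      s false + s true ≤ η * (1 - η ^ 3 + t) := by
  have hrot : ∀ v : Klein, ∀ {g : Perm (Ray × ZMod m)} {t : ℝ}, HasWeight η g t →
      HasWeight η ((if v.1 then top rot else 1) * g) ((if v.1 then 1 - η ^ 3 else 0) + t) := by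
    intro v g t hg
    cases v.1
    · simpa using hg
    · exact hg.rot_mul
  induction hg with
  | letter v k =>
    refine ⟨false, _, fun i => if i then weight η v.shift k else if v.1 then 1 - η ^ 3 else 0,
      modelLetter_eq_join v k, ?_, by simpa using weight_shift_le h v k⟩
    rintro (_ | _)
    · simpa using hrot v hasWeight_one
    · exact .letter _ _
  | @cons v k g t hg ih =>
    obtain ⟨ε, p, s, rfl, hp, hs⟩ := ih
    obtain ⟨r, hr, hr'⟩ := (hp ε).letter_mul h v.shift k
    -- After `join ε p` and the rotation, subtree `i` lies at the vertex `1` exactly when `i = ε`;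
    -- there the shifted letter acts.
    refine ⟨!ε, fun i => if i = ε then modelLetter v.shift k * p i
        else (if v.1 then top rot else 1) * p i,
      fun i => if i = ε then r else (if v.1 then 1 - η ^ 3 else 0) + s i, ?_, ?_, ?_⟩
    · rw [top_rot_eq_join, join_mul_join, modelLetter_eq_join, join_mul_join]
      congr 1
      · cases ε <;> rfl
      · ext1 i
        cases i <;> cases ε <;> simp [top_rot_eq_join]
    · intro i
      by_cases hi : i = ε
      · subst hi; simpa using hr'
      · simpa [hi] using hrot v (hp i)
    · have hv := weight_shift_le h v k
      cases ε
      · simp only [if_true, Bool.true_eq_false, if_false]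
        linarith
      · simp only [if_true, Bool.false_eq_true, if_false]
        linarith

/-- The values of words of length `n` in the local model have weight at most `n`. -/
theorem exists_hasWeight_wordValue (h : IsContraction η) (w : List Letter) :
    ∃ t ≤ (w.length : ℝ), HasWeight η (wordValue (modelDecoration m) w) t := by
  induction w with
  | nil => exact ⟨0, by simp, hasWeight_one⟩
  | cons l w ih =>
    obtain ⟨t, ht, hw⟩ := ih
    have e : wordValue (modelDecoration m) (l :: w) =
        l.value (modelDecoration m) * wordValue (modelDecoration m) w := by simp [wordValue]
    rw [e]
    simp only [List.length_cons, Nat.cast_add, Nat.cast_one]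
    rcases l with _ | ⟨v, k⟩
    · have := h.pos
      have h3 : 0 < η ^ 3 := by positivity
      exact ⟨_, by linarith, hw.rot_mul⟩
    · obtain ⟨s, hs, hs'⟩ := hw.letter_mul h v (k : ZMod m)
      rw [value_modelDecoration]
      have := weight_le_one h v (k : ZMod m)
      exact ⟨s, by linarith, hs'⟩

/-- There are finitely many elements of bounded weight. -/
theorem finite_hasWeight [NeZero m] (h : IsContraction η) (c : ℝ) :
    {g : Perm (Ray × ZMod m) | ∃ t ≤ c, HasWeight η g t}.Finite := by
  classical
  set S : Finset (Perm (Ray × ZMod m)) :=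
    insert (top rot) (Finset.univ.image fun p : Klein × ZMod m => modelLetter p.1 p.2)
  have ha : 0 < 1 - η ^ 3 := by
    have := h.cube_le; have := h.sq_le; have := h.lt_one; linarith
  refine (wordBall_finite S (1 + 2 * (c / (1 - η ^ 3)))).subset ?_
  rintro g ⟨t, ht, hg⟩
  -- Each rooted letter costs `1 - η ^ 3 > 0` and brings one directed letter, so the weight bounds
  -- the length.
  have key : ∃ l : List (Perm (Ray × ZMod m)), (∀ x ∈ l, x ∈ S) ∧
      (l.length : ℝ) ≤ 1 + 2 * (t / (1 - η ^ 3)) ∧ l.prod = g := by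
    clear ht
    have hS : ∀ v k, modelLetter v k ∈ S := fun v k =>
      Finset.mem_insert_of_mem (Finset.mem_image.2 ⟨(v, k), Finset.mem_univ _, rfl⟩)
    induction hg with
    | letter v k =>
      refine ⟨[modelLetter v k], by simpa using hS v k, ?_, by simp⟩
      have := div_nonneg (weight_nonneg h v k) ha.le
      simpa using this
    | @cons v k g t hg ih =>
      obtain ⟨l, hl, hlen, rfl⟩ := ih
      refine ⟨modelLetter v k :: top rot :: l, ?_, ?_, by simp⟩
      · intro x hx
        rcases List.mem_cons.1 hx with rfl | hx
        · exact hS v k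
        rcases List.mem_cons.1 hx with rfl | hx
        · exact Finset.mem_insert_self _ _
        · exact hl x hx
      · have := div_nonneg (weight_nonneg h v k) ha.le
        rw [add_div, add_div, div_self ha.ne']
        push_cast [List.length_cons]
        linarith
  obtain ⟨l, hl, hlen, rfl⟩ := key
  refine ⟨l, fun x hx => Or.inl (hl x hx), hlen.trans ?_, rfl⟩
  gcongr

end Model

end Grig

/-! ### Counting portraits. -/

namespace Grig

open Equiv Function Monomial

variable {A : Type*}

/-- `Portrait S g n` says that `g` is described by a binary tree with `n` leaves, labelled by
elements of `S`. -/
inductive Portrait (S : Set (Perm (Ray × A))) : Perm (Ray × A) → ℕ → Prop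
  | leaf {g : Perm (Ray × A)} (h : g ∈ S) : Portrait S g 1
  | node (ε : Bool) {p : Bool → Perm (Ray × A)} {n : Bool → ℕ} (h : ∀ i, Portrait S (p i) (n i)) :
      Portrait S (join ε p) (n false + n true)

theorem Portrait.pos {S : Set (Perm (Ray × A))} {g : Perm (Ray × A)} {n : ℕ}
    (h : Portrait S g n) : 0 < n := by
  induction h with
  | leaf _ => exact one_pos
  | node _ _ ih => have := ih false; omega

theorem catalan_le_four_pow (n : ℕ) : catalan n ≤ 4 ^ n := by
  rw [catalan_eq_centralBinom_div]
  refine (Nat.div_le_self _ _).trans ?_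
  rw [Nat.centralBinom]
  refine (Nat.choose_le_two_pow _ _).trans_eq ?_
  rw [pow_mul]; norm_num

/-- The number of portraits with `n + 1` leaves is bounded by a Catalan number. -/
theorem exists_finset_portrait (S : Finset (Perm (Ray × A))) {c : ℕ} (hc : S.card ≤ c) (n : ℕ) :
    ∃ F : Finset (Perm (Ray × A)), (∀ g, Portrait (S : Set _) g (n + 1) → g ∈ F) ∧
      2 * F.card ≤ catalan n * (2 * c) ^ (n + 1) := by
  classical
  induction n using Nat.strong_induction_on with
  -- A tree with `n + 1` leaves has `n` inner nodes, each with a choice of `ε`: there are `2 ^ n * c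
  -- ^ (n + 1)` labellings, whence the factor `2` on the left.
  | _ n ih =>
    rcases n with _ | n
    · have key : ∀ k g, Portrait (S : Set (Perm (Ray × A))) g k → k = 1 → g ∈ S := by
        intro k g hg hk
        cases hg with
        | leaf h => exact h
        | node ε h =>
          have h0 := (h false).pos
          have h1 := (h true).pos
          omega
      exact ⟨S, fun g hg => key _ g hg rfl, by simpa using hc⟩
    · choose! F hF hcard using ih
      refine ⟨Finset.univ.biUnion fun i : Fin (n + 1) =>
        (Finset.univ ×ˢ F i ×ˢ F (n - i)).image fun q : Bool × _ × _ =>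
          join q.1 fun j => if j then q.2.2 else q.2.1, ?_, ?_⟩
      · have key : ∀ k g, Portrait (S : Set (Perm (Ray × A))) g k → k = n + 1 + 1 →
            g ∈ Finset.univ.biUnion fun i : Fin (n + 1) =>
            (Finset.univ ×ˢ F i ×ˢ F (n - i)).image fun q : Bool × _ × _ =>
              join q.1 fun j => if j then q.2.2 else q.2.1 := by
          intro k g hg hk
          cases hg with
          | leaf _ => omega
          | @node ε p l h =>
            have h0 := (h false).pos
            have h1 := (h true).pos
            simp only [Finset.mem_biUnion, Finset.mem_image, Finset.mem_product]
            refine ⟨⟨l false - 1, by omega⟩, Finset.mem_univ _, (ε, p false, p true),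
              ⟨Finset.mem_univ _, hF _ (by dsimp only; omega) _ ?_, hF _ (by dsimp only; omega) _ ?_⟩, ?_⟩
            · simpa [Nat.sub_add_cancel h0] using h false
            · have : n - (l false - 1) + 1 = l true := by omega
              simpa [this] using h true
            · congr 1; ext1 j; cases j <;> rfl
        exact fun g hg => key _ g hg rfl
      · rw [catalan_succ, Finset.sum_mul]
        refine (Nat.mul_le_mul_left 2 Finset.card_biUnion_le).trans ?_
        rw [Finset.mul_sum]
        refine Finset.sum_le_sum fun i _ => ?_
        have h1 := hcard i (by omega)
        have h2 := hcard (n - i) (by omega)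
        refine (Nat.mul_le_mul_left 2 Finset.card_image_le).trans ?_
        simp only [Finset.card_product, Finset.card_univ, Fintype.card_bool]
        calc 2 * (2 * ((F i).card * (F (n - i)).card))
            = (2 * (F i).card) * (2 * (F (n - i)).card) := by ring
          _ ≤ (catalan i * (2 * c) ^ (i.val + 1)) * (catalan (n - i) * (2 * c) ^ (n - i + 1)) :=
            Nat.mul_le_mul h1 h2
          _ = catalan i * catalan (n - i) * ((2 * c) ^ (i.val + 1) * (2 * c) ^ (n - i + 1)) := by
            ring
          _ = _ := by
            rw [← pow_add]; congr 2; omega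

theorem exists_card_portrait_le {S : Set (Perm (Ray × A))} (hS : S.Finite) :
    ∃ D : ℕ, 2 ≤ D ∧ ∀ M : ℕ, {g | ∃ n ≤ M, Portrait S g n}.Finite ∧
      {g | ∃ n ≤ M, Portrait S g n}.ncard ≤ D ^ (M + 1) := by
  classical
  obtain ⟨S, rfl⟩ := hS.exists_finset_coe
  choose F hF hcard using exists_finset_portrait S (c := S.card + 1) (by omega)
  set D := 8 * (S.card + 1) with hD
  have hbound : ∀ n, (F n).card ≤ D ^ (n + 1) := fun n => by
    have h1 : (F n).card ≤ 2 * (F n).card := by omega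
    refine (h1.trans (hcard n)).trans ?_
    calc catalan n * (2 * (S.card + 1)) ^ (n + 1)
        ≤ 4 ^ (n + 1) * (2 * (S.card + 1)) ^ (n + 1) :=
          Nat.mul_le_mul_right _ ((catalan_le_four_pow n).trans
            (Nat.pow_le_pow_right (by norm_num) (by omega)))
      _ = D ^ (n + 1) := by rw [← mul_pow, hD]; ring_nf
  refine ⟨D, by omega, fun M => ?_⟩
  have hsub : {g | ∃ n ≤ M, Portrait (S : Set (Perm (Ray × A))) g n} ⊆
      ((Finset.range M).biUnion F : Finset _) := by
    rintro g ⟨n, hn, hg⟩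
    have := hg.pos
    refine Finset.mem_coe.2 (Finset.mem_biUnion.2 ⟨n - 1, Finset.mem_range.2 (by omega), ?_⟩)
    apply hF
    rwa [Nat.sub_add_cancel this]
  refine ⟨(Finset.finite_toSet _).subset hsub, ?_⟩
  refine (Set.ncard_le_ncard hsub (Finset.finite_toSet _)).trans ?_
  rw [Set.ncard_coe_finset]
  refine Finset.card_biUnion_le.trans ((Finset.sum_le_sum fun n _ => hbound n).trans ?_)
  have hD2 : 2 ≤ D := by omega
  clear hsub
  induction M with
  | zero => simp
  | succ M ih =>
    rw [Finset.sum_range_succ]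
    refine (Nat.add_le_add_right ih _).trans ?_
    rw [← two_mul, pow_succ D (M + 1), mul_comm (D ^ (M + 1))]
    exact Nat.mul_le_mul_right _ hD2

end Grig

/-! ### The growth exponent and the growth of the local model. -/

namespace Grig

open Equiv Function Monomial

theorem two_lt_etaPlus : 2 < etaPlus := by
  obtain ⟨h0, h⟩ := etaPlus_spec
  by_contra hc
  nlinarith [mul_nonneg (sq_nonneg etaPlus) (sub_nonneg.2 (not_lt.1 hc)), sq_nonneg (etaPlus - 1)]

/-- Clearing denominators turns the cubic for `2 / T` into `T³ - T² - 2T - 4 = 0`. -/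
theorem isContraction_etaPlus : IsContraction (2 / etaPlus) := by
  obtain ⟨h0, h⟩ := etaPlus_spec
  refine ⟨by positivity, (div_lt_one h0).2 two_lt_etaPlus, ?_⟩
  field_simp
  linear_combination -h

/-- The growth exponent `log 2 / log η₊`. -/
noncomputable def growthExponent : ℝ := Real.log 2 / Real.log etaPlus

theorem growthExponent_pos : 0 < growthExponent :=
  div_pos (Real.log_pos one_lt_two) (Real.log_pos (by have := two_lt_etaPlus; linarith))

theorem growthExponent_lt_one : growthExponent < 1 := by
  have h : Real.log 2 < Real.log etaPlus := Real.log_lt_log two_pos two_lt_etaPlus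
  have := Real.log_pos one_lt_two
  rw [growthExponent, div_lt_one (by linarith)]
  exact h

theorem etaPlus_rpow : etaPlus ^ growthExponent = 2 := by
  have h0 := etaPlus_spec.1
  have h : Real.log etaPlus ≠ 0 := (Real.log_pos (by have := two_lt_etaPlus; linarith)).ne'
  rw [Real.rpow_def_of_pos h0, growthExponent, mul_div_cancel₀ _ h, Real.exp_log two_pos]

/-- The bound for the number of leaves in a portrait of an element of weight `t`. -/
noncomputable def leafBound (t : ℝ) : ℝ := 2 * (t + 1) ^ growthExponent - 1

theorem one_le_leafBound {t : ℝ} (ht : 0 ≤ t) : 1 ≤ leafBound t := by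
  have := Real.one_le_rpow (x := t + 1) (by linarith) growthExponent_pos.le
  rw [leafBound]; linarith

theorem rpow_add_le {p y δ : ℝ} (hp : 0 ≤ p) (hp1 : p ≤ 1) (hy : 0 < y) (hδ : 0 ≤ δ) :
    (y + δ) ^ p ≤ y ^ p + δ * y ^ (p - 1) := by
  have h1 : y + δ = y * (1 + δ / y) := by field_simp
  have h2 : (1 + δ / y) ^ p ≤ 1 + p * (δ / y) :=
    rpow_one_add_le_one_add_mul_self (by have := div_nonneg hδ hy.le; linarith) hp hp1
  rw [h1, Real.mul_rpow hy.le (by positivity)]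
  have h3 : p * (δ / y) ≤ δ / y := mul_le_of_le_one_left (by positivity) hp1
  have h4 : y ^ (p - 1) = y ^ p / y := Real.rpow_sub_one hy.ne' p
  rw [h4]
  calc y ^ p * (1 + δ / y) ^ p ≤ y ^ p * (1 + δ / y) := by gcongr; linarith
    _ = _ := by ring

/-- By concavity the worst case is an even split, each part about `t / T`. Since `T ^ θ = 2` the
main terms then balance, and the `-1` in `leafBound` absorbs an error tending to `0`. -/
theorem exists_threshold {a : ℝ} (ha : 0 ≤ a) (ha1 : a ≤ 1) :
    ∃ c : ℝ, ∀ t ≥ c, ∀ t₀ ≥ 0, ∀ t₁ ≥ 0, t₀ + t₁ ≤ 2 / etaPlus * (a + t) →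
      t₀ ≤ t - 1 ∧ t₁ ≤ t - 1 ∧ leafBound t₀ + leafBound t₁ ≤ leafBound t := by
  have hT := two_lt_etaPlus
  have hη := isContraction_etaPlus
  have hθ := growthExponent_pos
  have hθ1 := growthExponent_lt_one
  set T := etaPlus
  set θ := growthExponent
  have hlim : Tendsto (fun y : ℝ => (a + T) * y ^ (-(1 - θ))) atTop (𝓝 ((a + T) * 0)) :=
    (tendsto_rpow_neg_atTop (by linarith)).const_mul _
  rw [mul_zero] at hlim
  obtain ⟨c₁, hc₁⟩ := eventually_atTop.1 (hlim.eventually_le_const (show (0 : ℝ) < 1 / 2 by norm_num))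
  -- The last bound gives `2 / T * (a + t) ≤ t - 1`, so both parts lose at least `1`.
  refine ⟨max (max c₁ 0) (2 / (1 - 2 / T)), fun t ht t₀ h₀ t₁ h₁ hsum => ?_⟩
  have ht1 : c₁ ≤ t := le_trans (le_trans (le_max_left _ _) (le_max_left _ _)) ht
  have ht0 : 0 ≤ t := le_trans (le_trans (le_max_right _ _) (le_max_left _ _)) ht
  have ht2 : 2 / (1 - 2 / T) ≤ t := le_trans (le_max_right _ _) ht
  have hη1 := hη.lt_one
  have hη0 := hη.pos
  rw [div_le_iff₀ (by linarith)] at ht2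
  have hle : 2 / T * (a + t) ≤ t - 1 := by nlinarith
  refine ⟨by linarith, by linarith, ?_⟩
  have hconc : 1 / 2 * (t₀ + 1) ^ θ + 1 / 2 * (t₁ + 1) ^ θ ≤
      (1 / 2 * (t₀ + 1) + 1 / 2 * (t₁ + 1)) ^ θ :=
    (Real.concaveOn_rpow hθ.le hθ1.le).2
      (show t₀ + 1 ∈ Set.Ici 0 from Set.mem_Ici.2 (by linarith))
      (show t₁ + 1 ∈ Set.Ici 0 from Set.mem_Ici.2 (by linarith))
      (by norm_num) (by norm_num) (by norm_num)
  have h2 : (1 / 2 * (t₀ + 1) + 1 / 2 * (t₁ + 1)) ^ θ ≤ ((t + (a + T)) / T) ^ θ := by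
    apply Real.rpow_le_rpow (by positivity) _ hθ.le
    have : (t + (a + T)) / T = 1 / 2 * (2 / T * (a + t)) + 1 := by field_simp; ring
    rw [this]; linarith
  rw [Real.div_rpow (by positivity) (by positivity), etaPlus_rpow] at h2
  have h3 : (t + (a + T)) ^ θ ≤ (t + 1 + (a + T)) ^ θ :=
    Real.rpow_le_rpow (by positivity) (by linarith) hθ.le
  have h4 := rpow_add_le hθ.le hθ1.le (show 0 < t + 1 by linarith) (show 0 ≤ a + T by linarith)
  have h5 := hc₁ (t + 1) (by linarith)
  rw [neg_sub] at h5
  simp only [leafBound]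
  linarith

/-- Elements of weight `t` have portraits with at most `leafBound t` leaves. -/
theorem exists_portrait (m : ℕ) : ∃ c : ℝ, ∀ (g : Perm (Ray × ZMod m)) (t : ℝ),
    HasWeight (2 / etaPlus) g t →
      ∃ n : ℕ, (n : ℝ) ≤ leafBound t ∧ Portrait {g | ∃ t ≤ c, HasWeight (2 / etaPlus) g t} g n := by
  have hη := isContraction_etaPlus
  obtain ⟨c, hc⟩ := exists_threshold (a := 1 - (2 / etaPlus) ^ 3)
    (by have := hη.cube_le; have := hη.sq_le; have := hη.lt_one; linarith)
    (by have := pow_pos hη.pos 3; linarith)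
  refine ⟨c, fun g t => ?_⟩
  -- Weights are real but drop by at least `1` at each splitting, so induction runs on an integer
  -- upper bound.
  obtain ⟨k, hk⟩ := exists_nat_ge t
  induction k generalizing g t with
  | zero =>
    intro hg
    rcases le_or_gt t c with h | h
    · exact ⟨1, by exact_mod_cast one_le_leafBound (hg.nonneg hη), .leaf ⟨t, h, hg⟩⟩
    · obtain ⟨ε, p, s, rfl, hp, hs⟩ := hg.exists_join hη
      have h0 := (hp false).nonneg hη
      have h1 := (hp true).nonneg hη
      have := (hc t h.le _ h0 _ h1 hs).1
      have := hg.nonneg hη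
      push_cast at hk
      linarith
  | succ k ih =>
    intro hg
    rcases le_or_gt t c with h | h
    · exact ⟨1, by exact_mod_cast one_le_leafBound (hg.nonneg hη), .leaf ⟨t, h, hg⟩⟩
    · obtain ⟨ε, p, s, rfl, hp, hs⟩ := hg.exists_join hη
      have h0 := (hp false).nonneg hη
      have h1 := (hp true).nonneg hη
      obtain ⟨hs0, hs1, hle⟩ := hc t h.le _ h0 _ h1 hs
      push_cast at hk
      have hex : ∀ i, ∃ n : ℕ, (n : ℝ) ≤ leafBound (s i) ∧
          Portrait {g | ∃ t ≤ c, HasWeight (2 / etaPlus) g t} (p i) n := by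
        rintro (_ | _)
        · exact ih _ _ (by linarith) (hp _)
        · exact ih _ _ (by linarith) (hp _)
      choose n hn hP using hex
      refine ⟨_, ?_, .node ε hP⟩
      push_cast
      linarith [hn false, hn true]

/-- The growth of the local model. -/
theorem exists_model_growth (m : ℕ) [NeZero m] : ∃ K : ℝ, 0 ≤ K ∧ ∀ r : ℝ, 0 ≤ r →
    {g | ∃ w : List Letter, (w.length : ℝ) ≤ r ∧ wordValue (modelDecoration m) w = g}.Finite ∧
    ({g | ∃ w : List Letter, (w.length : ℝ) ≤ r ∧
      wordValue (modelDecoration m) w = g}.ncard : ℝ) ≤ Real.exp (K * r ^ growthExponent) := by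
  have hη := isContraction_etaPlus
  have hθ := growthExponent_pos
  have hθ1 := growthExponent_lt_one
  obtain ⟨c, hc⟩ := exists_portrait m
  obtain ⟨D, hD2, hD⟩ := exists_card_portrait_le (finite_hasWeight (m := m) hη c)
  have hD0 : (0 : ℝ) < D := by positivity
  have hlog : 0 ≤ Real.log D := Real.log_natCast_nonneg D
  refine ⟨Real.log D * 4, by positivity, fun r hr => ?_⟩
  -- For `r < 1` there is only the empty word; for `r ≥ 1`, `leafBound r + 1 = 2 * (r + 1) ^ θ ≤ 4 *
  -- r ^ θ`.
  rcases lt_or_ge r 1 with h1 | h1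
  · have hsub : {g | ∃ w : List Letter, (w.length : ℝ) ≤ r ∧
        wordValue (modelDecoration m) w = g} ⊆ {1} := by
      rintro g ⟨w, hw, rfl⟩
      have : w.length < 1 := by exact_mod_cast hw.trans_lt h1
      rw [Nat.lt_one_iff, List.length_eq_zero_iff] at this
      subst this
      rfl
    refine ⟨(Set.finite_singleton _).subset hsub, ?_⟩
    have h2 := Set.ncard_le_ncard hsub
    rw [Set.ncard_singleton] at h2
    refine le_trans (by exact_mod_cast h2) (Real.one_le_exp ?_)
    positivity
  · have hL : 0 ≤ leafBound r := by have := one_le_leafBound hr; linarith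
    have hsub : {g | ∃ w : List Letter, (w.length : ℝ) ≤ r ∧
        wordValue (modelDecoration m) w = g} ⊆ {g | ∃ n ≤ ⌊leafBound r⌋₊,
          Portrait {g : Perm (Ray × ZMod m) | ∃ t ≤ c, HasWeight (2 / etaPlus) g t} g n} := by
      rintro g ⟨w, hw, rfl⟩
      obtain ⟨t, ht, hg⟩ := exists_hasWeight_wordValue (m := m) hη w
      obtain ⟨n, hn, hP⟩ := hc _ t hg
      refine ⟨n, Nat.le_floor (hn.trans ?_), hP⟩
      have := hg.nonneg hη
      unfold leafBound
      gcongr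
      linarith
    obtain ⟨hfin, hcard⟩ := hD ⌊leafBound r⌋₊
    refine ⟨hfin.subset hsub, ?_⟩
    have h2 : ({g | ∃ w : List Letter, (w.length : ℝ) ≤ r ∧
        wordValue (modelDecoration m) w = g}.ncard : ℝ) ≤ (D : ℝ) ^ (⌊leafBound r⌋₊ + 1) := by
      exact_mod_cast (Set.ncard_le_ncard hsub hfin).trans hcard
    refine h2.trans ?_
    rw [← Real.rpow_natCast, Real.rpow_def_of_pos hD0, Real.exp_le_exp, mul_assoc]
    refine mul_le_mul_of_nonneg_left ?_ hlog
    have h3 : (r + 1) ^ growthExponent ≤ 2 * r ^ growthExponent := by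
      calc (r + 1) ^ growthExponent ≤ (2 * r) ^ growthExponent :=
            Real.rpow_le_rpow (by linarith) (by linarith) hθ.le
        _ = 2 ^ growthExponent * r ^ growthExponent := Real.mul_rpow (by norm_num) hr
        _ ≤ 2 * r ^ growthExponent := by
            gcongr
            calc (2 : ℝ) ^ growthExponent ≤ 2 ^ (1 : ℝ) :=
                  Real.rpow_le_rpow_of_exponent_le (by norm_num) hθ1.le
              _ = 2 := Real.rpow_one 2
    have h4 := Nat.floor_le hL
    push_cast
    rw [leafBound] at h4 ⊢
    linarith

end Grig

/-! ### Recurrent sequences from the alternating group on five points. -/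

namespace Grig

open Equiv Function Monomial

open scoped commutatorElement

/-- In a group `Perm (ℤ × B)`, left translation over `0` is a commutator. -/
theorem exists_commutator_eq_single {B : Type*} (g : Perm B) :
    ⁅base (fun n : ℤ => if 0 ≤ n then g else 1), top (Equiv.addRight (1 : ℤ))⁆ =
      base (Pi.mulSingle (0 : ℤ) g) := by
  have h := top_mul_base_mul_inv (Equiv.addRight (1 : ℤ)) (fun n : ℤ => if 0 ≤ n then g else 1)
  rw [commutatorElement_def]
  -- The translation on `n ≥ 0` is divided by its shift, the translation on `n ≥ 1`.
  have e : ∀ v s : Perm (ℤ × B), v * s * v⁻¹ * s⁻¹ = v * (s * v * s⁻¹)⁻¹ := fun v s => by group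
  rw [e, h, ← map_inv, ← map_mul]
  congr 1
  ext1 n
  have hn : (Equiv.addRight (1 : ℤ))⁻¹ n = n - 1 := by
    rw [Perm.inv_eq_iff_eq]; simp
  simp only [Pi.mul_apply, Pi.inv_apply, hn]
  rcases lt_trichotomy n 0 with h | rfl | h
  · rw [if_neg (by omega), if_neg (by omega), Pi.mulSingle_eq_of_ne h.ne]; simp
  · simp
  · rw [if_pos (by omega), if_pos (by omega), Pi.mulSingle_eq_of_ne h.ne']; simp

/-- The alternating group on the copies of `Q`, conjugated by a permutation of the copy over `0`. -/
noncomputable def altConj {Q : Type*} (c : Perm Q) :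
    alternatingGroup (Fin 5) →* Perm (Fin 5 × Q) :=
  (MulAut.conj (base (Pi.mulSingle 0 c))).toMonoidHom.comp
    (top.comp (alternatingGroup (Fin 5)).subtype)

theorem altConj_apply {Q : Type*} (c : Perm Q) (σ : alternatingGroup (Fin 5)) :
    altConj c σ = base (Pi.mulSingle 0 c) * top (σ : Perm (Fin 5)) * (base (Pi.mulSingle 0 c))⁻¹ :=
  rfl

theorem altConj_mul_inv {Q : Type*} (c : Perm Q) (σ : alternatingGroup (Fin 5)) :
    altConj c σ * (altConj 1 σ)⁻¹ =
      base (Pi.mulSingle 0 c * Pi.mulSingle ((σ : Perm (Fin 5)) 0) c⁻¹) := by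
  rw [altConj_apply, altConj_apply, Pi.mulSingle_one, map_one, one_mul, inv_one, mul_one,
    mul_assoc, mul_assoc, ← mul_assoc (top _), ← map_inv base, top_mul_base_mul_inv, ← map_mul]
  congr 2
  ext1 i
  rw [← Pi.mulSingle_inv]
  by_cases h : i = (σ : Perm (Fin 5)) 0
  · subst h
    rw [Pi.mulSingle_eq_same, Perm.inv_eq_iff_eq.2 rfl, Pi.mulSingle_eq_same]
  · rw [Pi.mulSingle_eq_of_ne h, Pi.mulSingle_eq_of_ne]
    exact fun hc => h (Perm.inv_eq_iff_eq.1 hc)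

/-- Quotients of conjugated and plain copies give elements supported on `{0, 1}` and `{0, 2}`; their
commutator survives only over `0`. -/
theorem single_commutator_mem_of_altConj {Q : Type*} {L : Subgroup (Perm (Fin 5 × Q))}
    {c d : Perm Q} (h1 : ∀ σ, altConj 1 σ ∈ L) (hc : ∀ σ, altConj c σ ∈ L)
    (hd : ∀ σ, altConj d σ ∈ L) : base (Pi.mulSingle 0 ⁅c, d⁆) ∈ L := by
  have hσ : swap 0 1 * swap 1 2 ∈ alternatingGroup (Fin 5) := by
    rw [Perm.mem_alternatingGroup]; decide
  have hτ : swap 0 2 * swap 2 1 ∈ alternatingGroup (Fin 5) := by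
    rw [Perm.mem_alternatingGroup]; decide
  have h3 := mul_mem (hc ⟨_, hσ⟩) (inv_mem (h1 ⟨_, hσ⟩))
  have h4 := mul_mem (hd ⟨_, hτ⟩) (inv_mem (h1 ⟨_, hτ⟩))
  rw [altConj_mul_inv] at h3 h4
  have key : (Pi.mulSingle 0 ⁅c, d⁆ : Fin 5 → Perm Q) =
      ⁅(Pi.mulSingle 0 c * Pi.mulSingle ((swap 0 1 * swap 1 2 : Perm (Fin 5)) 0) c⁻¹ :
          Fin 5 → Perm Q),
        Pi.mulSingle 0 d * Pi.mulSingle ((swap 0 2 * swap 2 1 : Perm (Fin 5)) 0) d⁻¹⁆ := by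
    rw [show (swap 0 1 * swap 1 2 : Perm (Fin 5)) 0 = 1 by decide,
      show (swap 0 2 * swap 2 1 : Perm (Fin 5)) 0 = 2 by decide]
    ext1 i
    fin_cases i <;> simp [commutatorElement_def]
  rw [key, map_commutatorElement, commutatorElement_def]
  exact mul_mem (mul_mem (mul_mem h3 h4) (inv_mem h3)) (inv_mem h4)

/-- Every countable group embeds in a group of permutations generated, recurrently, by commutators
of a sequence of elements of exponent `60`. -/
theorem exists_recurrent (B : Type u) [Group B] [Countable B] :
    ∃ (Z : Type u) (b : ℕ → Perm Z), Recurrent b ∧ (∀ n, b n ^ 60 = 1) ∧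
      ∃ f : B →* Perm Z, Injective f ∧ ∀ x, f x ∈ lateCommutators b 0 := by
  let Q := ℤ × B
  let coef : Option (Option B) → Perm Q := fun o => match o with
    | none => 1
    | some none => top (Equiv.addRight (1 : ℤ))
    | some (some x) => base (fun n : ℤ => if 0 ≤ n then MulAction.toPermHom B B x else 1)
  obtain ⟨e, he⟩ := exists_surjective_nat (Option (Option B) × alternatingGroup (Fin 5))
  let elt : Option (Option B) × alternatingGroup (Fin 5) → Perm (Fin 5 × Q) :=
    fun j => altConj (coef j.1) j.2
  -- The pairing makes every element recur infinitely often.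
  let b : ℕ → Perm (Fin 5 × Q) := fun n => elt (e n.unpair.1)
  have hb : ∀ N j, ∃ i ≥ N, b i = elt j := by
    intro N j
    obtain ⟨k, rfl⟩ := he j
    exact ⟨Nat.pair k N, Nat.right_le_pair k N, by simp [b]⟩
  have hL : ∀ N o σ, altConj (coef o) σ ∈ lateCommutators b N := by
    intro N o σ
    have hle : (⊤ : Subgroup (alternatingGroup (Fin 5))) ≤
        (lateCommutators b N).comap (altConj (coef o)) := by
      -- `A_5` is perfect, so each conjugated copy is generated by commutators of its own elements,
      -- which all occur late in `b`.
      rw [← commutator_alternatingGroup_eq_top (α := Fin 5) (by simp), commutator_eq_closure]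
      refine (Subgroup.closure_le _).2 ?_
      rintro _ ⟨σ, τ, rfl⟩
      obtain ⟨i, hi, hbi⟩ := hb N (o, σ)
      obtain ⟨j, hj, hbj⟩ := hb N (o, τ)
      refine Subgroup.subset_closure ⟨i, hi, j, hj, ?_⟩
      rw [hbi, hbj, map_commutatorElement]
    exact hle (Subgroup.mem_top σ)
  refine ⟨Fin 5 × Q, b, fun N n => hL N _ _, fun n => ?_, ?_⟩
  · have hcard : Nat.card (alternatingGroup (Fin 5)) = 60 := by
      rw [nat_card_alternatingGroup]; simp [Nat.factorial]
    change altConj _ _ ^ 60 = 1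
    rw [← map_pow, ← hcard, pow_card_eq_one', map_one]
  · refine ⟨(base.comp (MonoidHom.mulSingle (fun _ : Fin 5 => Perm Q) 0)).comp
      ((base.comp (MonoidHom.mulSingle (fun _ : ℤ => Perm B) 0)).comp (MulAction.toPermHom B B)),
      ?_, fun x => ?_⟩
    · have h1 := base_injective.comp (Pi.mulSingle_injective (M := fun _ : Fin 5 => Perm Q) 0)
      have h2 := base_injective.comp (Pi.mulSingle_injective (M := fun _ : ℤ => Perm B) 0)
      exact h1.comp (h2.comp MulAction.toPerm_injective)
    · have := single_commutator_mem_of_altConj (hL 0 none) (hL 0 (some (some x))) (hL 0 (some none))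
      rw [show coef (some none) = top (Equiv.addRight (1 : ℤ)) from rfl,
        show coef (some (some x)) = base (fun n : ℤ => if 0 ≤ n then MulAction.toPermHom B B x
          else 1) from rfl, exists_commutator_eq_single] at this
      exact this

end Grig

/-! ### Submultiplicativity, and exponential growth from free subgroups. -/

section Growth

variable {G : Type u} [Group G]

theorem growth_mul_le (S : Finset G) (n k : ℕ) :
    growth S ((k * n : ℕ) : ℝ) ≤ growth S (n : ℝ) ^ k := by
  induction k with
  | zero =>
    have : wordBall S ((0 * n : ℕ) : ℝ) ⊆ {1} := by
      rintro g ⟨l, -, hl, rfl⟩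
      have : l.length = 0 := by simpa using hl
      rw [List.length_eq_zero_iff.1 this]; rfl
    have h := Set.ncard_le_ncard this
    rwa [Set.ncard_singleton] at h
  | succ k ih =>
    rw [add_mul, one_mul, pow_succ]
    exact (growth_add_le S _ _).trans (Nat.mul_le_mul_right _ ih)

theorem tendsto_volumeEntropy_mul (S : Finset G) {n : ℕ} (hn : 0 < n) :
    Tendsto (fun k : ℕ => Real.log (growth S ((k * n : ℕ) : ℝ)) / ((k * n : ℕ) : ℝ)) atTop
      (𝓝 (volumeEntropy S)) :=
  (tendsto_volumeEntropy S).comp (tendsto_natCast_atTop_atTop.comp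
    (tendsto_id.atTop_mul_const' hn))

theorem volumeEntropy_le (S : Finset G) {n : ℕ} (hn : 0 < n) :
    volumeEntropy S ≤ Real.log (growth S (n : ℝ)) / n := by
  refine le_of_tendsto (tendsto_volumeEntropy_mul S hn) ?_
  filter_upwards [eventually_gt_atTop 0] with k hk
  have h1 : (growth S ((k * n : ℕ) : ℝ) : ℝ) ≤ (growth S (n : ℝ) : ℝ) ^ k := by
    exact_mod_cast growth_mul_le S n k
  have h2 : (0 : ℝ) < growth S ((k * n : ℕ) : ℝ) := by
    exact_mod_cast growth_pos S (Nat.cast_nonneg _)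
  have h3 := Real.log_le_log h2 h1
  rw [Real.log_pow] at h3
  have hk' : (0 : ℝ) < k := by exact_mod_cast hk
  have hn' : (0 : ℝ) < n := by exact_mod_cast hn
  push_cast at h3 ⊢
  rw [div_le_div_iff₀ (by positivity) hn']
  nlinarith

theorem volumeEntropy_pos_of_two_pow_le (S : Finset G) {k : ℕ} (hk : 0 < k)
    (h : ∀ n : ℕ, 2 ^ n ≤ growth S ((n * k : ℕ) : ℝ)) : 0 < volumeEntropy S := by
  have hk' : (0 : ℝ) < k := by exact_mod_cast hk
  have hlog : 0 < Real.log 2 / k := div_pos (Real.log_pos one_lt_two) hk'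
  refine hlog.trans_le (ge_of_tendsto (tendsto_volumeEntropy_mul S hk) ?_)
  filter_upwards [eventually_gt_atTop 0] with n hn
  have hn' : (0 : ℝ) < n := by exact_mod_cast hn
  have h1 : (2 : ℝ) ^ n ≤ growth S ((n * k : ℕ) : ℝ) := by exact_mod_cast h n
  have h2 := Real.log_le_log (by positivity) h1
  rw [Real.log_pow] at h2
  push_cast at h2 ⊢
  rw [div_le_div_iff₀ hk' (by positivity)]
  nlinarith

theorem exists_mem_wordBall {S : Finset G} (hS : Subgroup.closure (S : Set G) = ⊤) (g : G) :
    ∃ n : ℕ, g ∈ wordBall S (n : ℝ) := by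
  have hg : g ∈ (Subgroup.closure (S : Set G)).toSubmonoid := by rw [hS]; trivial
  rw [Subgroup.closure_toSubmonoid] at hg
  obtain ⟨l, hl, rfl⟩ := Submonoid.exists_list_of_mem_closure hg
  exact ⟨l.length, l, fun x hx => by simpa using hl x hx, le_rfl, rfl⟩

theorem wordBall_mono (S : Finset G) {r s : ℝ} (h : r ≤ s) : wordBall S r ⊆ wordBall S s := by
  rintro g ⟨l, hl, hr, rfl⟩
  exact ⟨l, hl, hr.trans h, rfl⟩

theorem list_prod_mem_wordBall {S : Finset G} {k : ℕ} (l : List G)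
    (hl : ∀ x ∈ l, x ∈ wordBall S (k : ℝ)) : l.prod ∈ wordBall S ((l.length * k : ℕ) : ℝ) := by
  induction l with
  | nil => exact one_mem_wordBall S (Nat.cast_nonneg _)
  | cons x l ih =>
    obtain ⟨l₁, h₁, hr₁, hp₁⟩ := hl x (List.mem_cons_self ..)
    obtain ⟨l₂, h₂, hr₂, hp₂⟩ := ih fun y hy => hl y (List.mem_cons_of_mem _ hy)
    refine ⟨l₁ ++ l₂, fun y hy => (List.mem_append.1 hy).elim (h₁ y) (h₂ y), ?_, by
      rw [List.prod_append, hp₁, hp₂, List.prod_cons]⟩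
    push_cast [List.length_append, List.length_cons] at hr₂ ⊢
    linarith

theorem freeGroup_map_of_prod (l : List Bool) :
    (l.map FreeGroup.of).prod = FreeGroup.mk (l.map fun i => (i, true)) := by
  induction l with
  | nil => rfl
  | cons i l ih => rw [List.map_cons, List.prod_cons, ih]; rfl

/-- Positive words are reduced; they supply the `2 ^ n` distinct elements. -/
theorem freeGroup_map_of_prod_injective :
    Function.Injective fun l : List Bool => (l.map FreeGroup.of).prod := by
  have hred : ∀ l : List Bool, FreeGroup.IsReduced (l.map fun i => (i, true)) := fun l => by
    rw [FreeGroup.IsReduced, List.isChain_map]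
    exact (List.pairwise_of_forall fun _ _ _ => rfl).isChain
  intro l l' h
  simp only [freeGroup_map_of_prod] at h
  have h2 := congrArg FreeGroup.toWord h
  rw [FreeGroup.toWord_mk, FreeGroup.toWord_mk, (hred l).reduce_eq, (hred l').reduce_eq] at h2
  exact List.map_injective_iff.2 (fun _ _ h => congrArg Prod.fst h) h2

/-- A group containing a free group of rank two has exponential growth. -/
theorem volumeEntropy_pos_of_freeGroup (f : FreeGroup Bool →* G) (hf : Function.Injective f)
    {S : Finset G} (hS : Subgroup.closure (S : Set G) = ⊤) : 0 < volumeEntropy S := by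
  choose k hk using fun i => exists_mem_wordBall hS (f (FreeGroup.of i))
  refine volumeEntropy_pos_of_two_pow_le S (k := k false + k true + 1) (by omega) fun n => ?_
  have hball : ∀ i, f (FreeGroup.of i) ∈ wordBall S ((k false + k true + 1 : ℕ) : ℝ) := by
    rintro (_ | _)
    · exact wordBall_mono S (by push_cast; linarith [(k true).cast_nonneg (α := ℝ)]) (hk false)
    · exact wordBall_mono S (by push_cast; linarith [(k false).cast_nonneg (α := ℝ)]) (hk true)
  let F : (Fin n → Bool) → G := fun p => f ((List.ofFn p).map FreeGroup.of).prod
  have hF : Function.Injective F :=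
    hf.comp (freeGroup_map_of_prod_injective.comp List.ofFn_injective)
  have hsub : Set.range F ⊆ wordBall S ((n * (k false + k true + 1) : ℕ) : ℝ) := by
    rintro _ ⟨p, rfl⟩
    have := list_prod_mem_wordBall (S := S) ((List.ofFn p).map fun i => f (FreeGroup.of i))
      (k := k false + k true + 1) (by
        intro x hx
        obtain ⟨i, -, rfl⟩ := List.mem_map.1 hx
        exact hball i)
    rw [List.length_map, List.length_ofFn] at this
    convert this using 1
    change f _ = _
    rw [map_list_prod, List.map_map]; rfl
  have := Set.ncard_le_ncard hsub (wordBall_finite S _)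
  rw [← Set.image_univ, Set.ncard_image_of_injective _ hF, Set.ncard_univ] at this
  simpa [growth] using this

end Growth

/-! ### Transfer of the growth bound and conclusion. -/

namespace Grig

open Equiv Function Monomial

variable {Z : Type u}

/-- The standard generators of a decorated group. -/
noncomputable def decoratedGens (b : ℕ → Perm Z) (N : ℕ) : Set (Perm (Ray × Z)) :=
  insert (base (decoration b N)) (top '' insert rot (Set.range kdir))

theorem finite_decoratedGens (b : ℕ → Perm Z) (N : ℕ) : (decoratedGens b N).Finite :=
  (((Set.finite_range _).insert _).image _).insert _

theorem exists_letter {b : ℕ → Perm Z} {N : ℕ} {x : Perm (Ray × Z)}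
    (hx : x ∈ decoratedGens b N ∨ x⁻¹ ∈ decoratedGens b N) :
    ∃ l : Letter, l.value (decoration b N) = x := by
  have hk : top (kdir (false, false)) = (1 : Perm (Ray × Z)) := by rw [kdir_one, map_one]
  rcases hx with (rfl | ⟨_, rfl | ⟨v, rfl⟩, rfl⟩) | (h | ⟨_, rfl | ⟨v, rfl⟩, h⟩)
  · exact ⟨some ((false, false), 1), by simp [Letter.value, hk]⟩
  · exact ⟨none, rfl⟩
  · exact ⟨some (v, 0), by simp [Letter.value]⟩
  · refine ⟨some ((false, false), -1), ?_⟩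
    rw [← inv_inv x, h]
    simp [Letter.value, hk]
  · refine ⟨none, ?_⟩
    rw [← inv_inv x, ← h, ← map_inv, rot_inv]; rfl
  · refine ⟨some (v, 0), ?_⟩
    rw [← inv_inv x, ← h, ← map_inv, kdir_inv]; simp [Letter.value]

/-- The standard generators of `decorated b N` generate the group `decorated b 0`. -/
theorem Recurrent.exists_generators {b : ℕ → Perm Z} (hb : Recurrent b) (N : ℕ) :
    ∃ S : Finset (decorated b 0), Subgroup.closure (S : Set (decorated b 0)) = ⊤ ∧
      ∀ x ∈ S, (x : Perm (Ray × Z)) ∈ decoratedGens b N := by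
  rw [← hb.decorated_eq N]
  have hfin : ((↑) ⁻¹' decoratedGens b N : Set (decorated b N)).Finite :=
    (finite_decoratedGens b N).preimage Subtype.val_injective.injOn
  refine ⟨hfin.toFinset, ?_, fun x hx => by simpa using hx⟩
  rw [Set.Finite.coe_toFinset]
  exact Subgroup.closure_closure_coe_preimage

/-- Small balls in a decorated group are no larger than balls in the local model. -/
theorem growth_le_model {b : ℕ → Perm Z} {m : ℕ} (hm : ∀ n, b n ^ m = 1)
    {H : Subgroup (Perm (Ray × Z))} {N R : ℕ} (hR : 2 * R ≤ N) {S : Finset H}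
    (hS : ∀ x ∈ S, (x : Perm (Ray × Z)) ∈ decoratedGens b N) {r : ℝ} (hr : r ≤ R)
    (hfin : {g | ∃ w : List Letter, (w.length : ℝ) ≤ r ∧
      wordValue (modelDecoration m) w = g}.Finite) :
    growth S r ≤ {g | ∃ w : List Letter, (w.length : ℝ) ≤ r ∧
      wordValue (modelDecoration m) w = g}.ncard := by
  have key : ∀ g ∈ wordBall S r, ∃ w : List Letter, (w.length : ℝ) ≤ r ∧
      wordValue (decoration b N) w = (g : Perm (Ray × Z)) := by
    rintro _ ⟨l, hl, hlen, rfl⟩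
    have : ∃ w : List Letter, w.length = l.length ∧
        wordValue (decoration b N) w = (l.prod : Perm (Ray × Z)) := by
      clear hlen
      induction l with
      | nil => exact ⟨[], rfl, rfl⟩
      | cons x l ih =>
        obtain ⟨w, hw, hw'⟩ := ih fun y hy => hl y (List.mem_cons_of_mem _ hy)
        obtain ⟨a, ha⟩ := exists_letter ((hl x (List.mem_cons_self ..)).imp (hS x)
          fun h => by simpa using hS _ h)
        refine ⟨a :: w, by simp [hw], ?_⟩
        have e : wordValue (decoration b N) (a :: w) =
            a.value (decoration b N) * wordValue (decoration b N) w := by simp [wordValue]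
        rw [e, ha, hw']
        simp
    obtain ⟨w, hw, hw'⟩ := this
    exact ⟨w, by rwa [hw], hw'⟩
  choose! W hW hW' using key
  have hlen : ∀ g ∈ wordBall S r, (W g).length ≤ R := fun g hg => by
    exact_mod_cast (hW g hg).trans hr
  -- A short word is chosen for each `g` and evaluated in the model; no homomorphism is needed, only
  -- injectivity on the ball.
  refine Set.ncard_le_ncard_of_injOn (fun g => wordValue (modelDecoration m) (W g))
    (fun g hg => ⟨W g, hW g hg, rfl⟩) (fun g hg h hh heq => ?_) hfin
  apply Subtype.ext
  rw [← hW' g hg, ← hW' h hh]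
  exact wordValue_eq_of_model b hm hR (hlen g hg) (hlen h hh) heq

end Grig

open Grig Equiv in
theorem mainTheorem3 (B : Type u) [Group B] [Countable B] :
    ∃ (W : Type u) (_ : Group W),
      (∃ f : B →* W, Function.Injective f) ∧
      HasNonuniformExponentialGrowth W ∧
      ∃ K : ℝ, ∀ R : ℝ, 0 < R →
        ∃ S : Finset W, Subgroup.closure (S : Set W) = ⊤ ∧
          ∀ r : ℝ, 0 ≤ r → r ≤ R →
            (growth S r : ℝ) ≤ Real.exp (K * r ^ (Real.log 2 / Real.log etaPlus)) := by
  -- The free factor serves only to force positive entropy.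
  obtain ⟨Z, b, hb, hexp, f, hf, hfmem⟩ := exists_recurrent (B × FreeGroup Bool)
  obtain ⟨K, hK, hmodel⟩ := exists_model_growth 60
  let F : B × FreeGroup Bool →* decorated b 0 :=
    ((Monomial.base.comp (MonoidHom.mulSingle (fun _ : Ray => Perm Z) ones)).comp f).codRestrict
      (decorated b 0) fun x => hb.single_mem 0 (hfmem x) cofinal_ones
  have hF : Function.Injective F := by
    have h1 := Monomial.base_injective.comp
      ((Pi.mulSingle_injective (M := fun _ : Ray => Perm Z) ones).comp hf)
    intro x y hxy
    exact h1 (congrArg Subtype.val hxy)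
  have hmain : ∀ R : ℝ, ∃ S : Finset (decorated b 0),
      Subgroup.closure (S : Set (decorated b 0)) = ⊤ ∧ ∀ r : ℝ, 0 ≤ r → r ≤ R →
        (growth S r : ℝ) ≤ Real.exp (K * r ^ growthExponent) := by
    intro R
    obtain ⟨S, hS, hgen⟩ := hb.exists_generators (2 * ⌈R⌉₊)
    refine ⟨S, hS, fun r hr hrR => ?_⟩
    obtain ⟨hfin, hle⟩ := hmodel r hr
    refine le_trans ?_ hle
    exact_mod_cast growth_le_model hexp le_rfl hgen (hrR.trans (Nat.le_ceil R)) hfin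
  have hpos : ∀ S : Finset (decorated b 0), Subgroup.closure (S : Set (decorated b 0)) = ⊤ →
      0 < volumeEntropy S := fun S hS =>
    volumeEntropy_pos_of_freeGroup (F.comp (MonoidHom.inr B (FreeGroup Bool)))
      (hF.comp (Prod.mk_right_injective 1)) hS
  refine ⟨decorated b 0, inferInstance, ⟨F.comp (MonoidHom.inl B (FreeGroup Bool)),
    hF.comp (Prod.mk_left_injective 1)⟩, ⟨?_, hpos, ?_, ?_⟩, K, fun R _ => hmain R⟩
  · obtain ⟨S, hS, -⟩ := hmain 0
    exact Group.fg_iff.2 ⟨S, hS, S.finite_toSet⟩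
  · rintro _ ⟨S, hS, rfl⟩
    exact (hpos S hS).le
  · intro x hx
    -- The bound on the ball of radius `n` alone gives entropy at most `K * n ^ (θ - 1)` for a
    -- suitable generating set, with `K` independent of `n`.
    have hlim : Tendsto (fun n : ℕ => K * (n : ℝ) ^ (-(1 - growthExponent))) atTop (𝓝 (K * 0)) :=
      ((tendsto_rpow_neg_atTop (by linarith [growthExponent_lt_one])).comp
        tendsto_natCast_atTop_atTop).const_mul _
    rw [mul_zero] at hlim
    refine ge_of_tendsto hlim ?_
    filter_upwards [eventually_gt_atTop 0] with n hn
    have hn' : (0 : ℝ) < n := by exact_mod_cast hn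
    obtain ⟨S, hS, hgr⟩ := hmain n
    refine (hx ⟨S, hS, rfl⟩).trans ((volumeEntropy_le S hn).trans ?_)
    have h1 := Real.log_le_log (by exact_mod_cast growth_pos S hn'.le) (hgr n hn'.le le_rfl)
    rw [Real.log_exp] at h1
    rw [neg_sub, Real.rpow_sub_one hn'.ne', ← mul_div_assoc]
    gcongr
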